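/- A *virtual tangle diagram* with $n$ strings is a generic immersion in the disk of $n$ oriented intervals (strings, with their $2n$ endpoints at fixed points of the boundary circle) and finitely many oriented circles (closed components), each of whose double points is either a real crossing, with a choice of the overpass, or a virtual crossing, without such a choice. It is *classical* if it has no virtual crossings. It is *ordered* if the inputs of its strings are numbered by $1,3,\dots,2n-1$ and the outputs by $2,4,\dots,2n$; the input $2k-1$ and the output $2k$ need not belong to the same string. *Ordered virtual tangles* are the classes of ordered virtual tangle diagrams under planar isotopy fixed on the boundary circle and the real, virtual and mixed oriented Reidemeister moves; *ordered classical tangles* are the classes of ordered classical diagrams under planar isotopy fixed on the boundary circle and the real oriented Reidemeister moves. Endpoints and their numbers are kept by all moves. Let $D$ be an ordered diagram. For a set $S$ of real crossings of $D$, let $D(S)$ be obtained by smoothing the crossings of $S$ according to the orientation. The set $S$ is a *descending $m$-state* if it has $m$ elements, $D(S)$ has no closed components, each string of $D(S)$ leads from the input $2k-1$ to the output $2k$ for some $k$, and, if one runs along the strings of $D(S)$ from input to output, one after the other in the order of their numbers, then one comes to each crossing of $S$ first on its former overpass and later on its former underpass. Let $$c_m(D)=\sum_{S}\prod_{c\in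 S}\operatorname{sign}(c),\qquad \nabla(D)=\sum_{m\ge 0}c_m(D)\,z^m\in\mathbb Z[z],$$ where $S$ runs over the descending $m$-states of $D$ and $\operatorname{sign}(c)=\pm1$ is the local writhe number of $c$. **Theorem.** $\nabla(D)$ depends only on the ordered tangle represented by $D$: there is exactly one function on ordered virtual tangles whose value at the tangle of each diagram $D$ is $\nabla(D)$, and likewise for ordered classical tangles and classical diagrams. -/

import Mathlib

namespace OrderedTangle

/-! ### Diagrams

A tangle diagram is a finite oriented graph drawn in the disk. Its vertices are the crossings
(four-valent) and some auxiliary marks (two-valent points on the arcs); the marks make it possible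
to describe a component without crossings, and they may be added and removed freely.

Draw each crossing with both of its strands going upwards. It has two incoming ends, below, and two
outgoing ends, above, in each case a left one and a right one. The strand that comes in on the left
goes out on the right, and the other way round. -/

/-- The two sides of a crossing. -/
abbrev Side : Type := Bool

abbrev left : Side := false

abbrev right : Side := true

/-- The kinds of crossings: real ones, positive or negative, and virtual ones. -/
inductive Kind : Type where
  | pos
  | neg
  | virt

/-- The sign (local writhe number) of a real crossing; the value at `virt` is never used. -/
def Kind.sign : Kind → ℤ
  | .pos => 1
  | .neg => -1
  | .virt => 0

/-- The side on which the overpass of a real crossing comes in: the overpass goes from the left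
below to the right above iff the crossing is positive. The value at `virt` is never used. -/
def Kind.over : Kind → Side
  | .pos => left
  | .neg => right
  | .virt => left

/-- Exchange of overpass and underpass. -/
def Kind.flip : Kind → Kind
  | .pos => .neg
  | .neg => .pos
  | .virt => .virt

/-- A diagram with one input and one output for each element of `I`. The arcs are the values of
`next`: an arc starts at an input of the diagram, at an outgoing end of a crossing, or at a mark,
and it leads to an output of the diagram, to an incoming end of a crossing, or to a mark. -/
structure Diagram (I : Type) where
  /-- the crossings -/
  X : Type
  /-- the marks -/
  M : Type
  [fintypeX : Fintype X]
  [fintypeM : Fintype M]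
  kind : X → Kind
  next : I ⊕ (X × Side ⊕ M) ≃ I ⊕ (X × Side ⊕ M)

attribute [instance] Diagram.fintypeX Diagram.fintypeM

/-- A diagram is classical if it has no virtual crossings. -/
def Diagram.IsClassical {I : Type} (D : Diagram I) : Prop :=
  ∀ c, D.kind c ≠ Kind.virt

/-! ### Planarity

The inputs and the outputs are points of the boundary circle; collapsing the boundary circle to one
more vertex, we get a graph with a cyclic order of the ends at each vertex, which is drawn in the
sphere iff `V - E + F = 2 C`. -/

/-- The ends of the arcs: `Sum.inl` for the starting point of an arc, `Sum.inr` for its target. -/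
abbrev Diagram.End {I : Type} (D : Diagram I) : Type :=
  (I ⊕ (D.X × Side ⊕ D.M)) ⊕ (I ⊕ (D.X × Side ⊕ D.M))

/-- The other end of the same arc. -/
def Diagram.opposite {I : Type} (D : Diagram I) : D.End → D.End
  | Sum.inl a => Sum.inr (D.next a)
  | Sum.inr b => Sum.inl (D.next.symm b)

/-- The next end in the counterclockwise order around the same vertex. `pos` is the position of the
inputs (`Sum.inl`) and outputs (`Sum.inr`) on the boundary circle, counted counterclockwise from the
base point. The counterclockwise order around the vertex that replaces the outside of the disk is
the clockwise order along the boundary circle. -/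
def Diagram.rotate {n : ℕ} (pos : Fin n ⊕ Fin n ≃ Fin (2 * n)) (D : Diagram (Fin n)) :
    D.End → D.End
  | Sum.inl (Sum.inr (Sum.inl (c, true))) => Sum.inl (Sum.inr (Sum.inl (c, left)))
  | Sum.inl (Sum.inr (Sum.inl (c, false))) => Sum.inr (Sum.inr (Sum.inl (c, left)))
  | Sum.inr (Sum.inr (Sum.inl (c, false))) => Sum.inr (Sum.inr (Sum.inl (c, right)))
  | Sum.inr (Sum.inr (Sum.inl (c, true))) => Sum.inl (Sum.inr (Sum.inl (c, right)))
  | Sum.inl (Sum.inr (Sum.inr m)) => Sum.inr (Sum.inr (Sum.inr m))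
  | Sum.inr (Sum.inr (Sum.inr m)) => Sum.inl (Sum.inr (Sum.inr m))
  | Sum.inl (Sum.inl k) =>
      Sum.map Sum.inl Sum.inl (pos.symm ((finRotate (2 * n)).symm (pos (Sum.inl k))))
  | Sum.inr (Sum.inl k) =>
      Sum.map Sum.inl Sum.inl (pos.symm ((finRotate (2 * n)).symm (pos (Sum.inr k))))

/-- The number of cycles of a permutation of a finite set. -/
noncomputable def numCycles {A : Type} (f : A → A) : ℕ :=
  Nat.card (Quot fun a b => f a = b)

/-- The number of connected components of the graph. -/
noncomputable def Diagram.numComponents {n : ℕ} (pos : Fin n ⊕ Fin n ≃ Fin (2 * n))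
    (D : Diagram (Fin n)) : ℕ :=
  Nat.card (Quot fun a b : D.End => D.rotate pos a = b ∨ D.opposite a = b)

/-- The diagram is drawn in the disk, with the ends of its strings at the positions `pos`. -/
def Diagram.IsPlane {n : ℕ} (pos : Fin n ⊕ Fin n ≃ Fin (2 * n)) (D : Diagram (Fin n)) : Prop :=
  numCycles (D.rotate pos) + numCycles (fun a => D.rotate pos (D.opposite a)) =
    numCycles D.opposite + 2 * D.numComponents pos

/-! ### States -/

open Classical in
/-- How one passes through a vertex in the smoothed diagram `D(S)`: at a crossing in `S` one stays
on the same side, at any other crossing one goes straight on. -/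
noncomputable def Diagram.turn {I : Type} (D : Diagram I) (S : Finset D.X) :
    D.X × Side ⊕ D.M → D.X × Side ⊕ D.M
  | Sum.inl (c, s) => Sum.inl (c, if c ∈ S then s else !s)
  | Sum.inr m => Sum.inr m

/-- One step along `D(S)`: through a vertex and along the arc that follows. One stops at outputs. -/
noncomputable def Diagram.step {I : Type} (D : Diagram I) (S : Finset D.X) :
    I ⊕ (D.X × Side ⊕ D.M) → I ⊕ (D.X × Side ⊕ D.M)
  | Sum.inl i => Sum.inl i
  | Sum.inr p => D.next (Sum.inr (D.turn S p))

/-- The place that one reaches at time `m` on the string of `D(S)` that starts at the input `i`: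
an output (`Sum.inl`), an incoming end of a crossing or a mark (`Sum.inr`). -/
noncomputable def Diagram.walk {I : Type} (D : Diagram I) (S : Finset D.X) (i : I) (m : ℕ) :
    I ⊕ (D.X × Side ⊕ D.M) :=
  (D.step S)^[m] (D.next (Sum.inl i))

/-- `S` is coherent: each string of `D(S)` leads from an input to the output with the same number,
and `D(S)` has no closed components. -/
def Diagram.IsCoherent {I : Type} (D : Diagram I) (S : Finset D.X) : Prop :=
  (∀ i, ∃ m, D.walk S i m = Sum.inl i) ∧ ∀ p, ∃ i m, D.walk S i m = Sum.inr p

/-- `S` is a descending state: a coherent set of real crossings, such that on the way along the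
strings of `D(S)`, one after the other, one comes to each crossing of `S` first on its (former)
overpass and then on its underpass. -/
def Diagram.IsDescending {I : Type} [LinearOrder I] (D : Diagram I) (S : Finset D.X) : Prop :=
  (∀ c ∈ S, D.kind c ≠ Kind.virt) ∧ D.IsCoherent S ∧
    ∀ c ∈ S, ∀ i m i' m',
      D.walk S i m = Sum.inr (Sum.inl (c, (D.kind c).over)) →
      D.walk S i' m' = Sum.inr (Sum.inl (c, !(D.kind c).over)) →
      i < i' ∨ i = i' ∧ m < m'

open Classical in
/-- The signed count of the descending `m`-states. -/
noncomputable def Diagram.coeff {I : Type} [LinearOrder I] (D : Diagram I) (m : ℕ) : ℤ :=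
  ∑ S : Finset D.X with S.card = m ∧ D.IsDescending S, ∏ c ∈ S, (D.kind c).sign

/-- `∇(D) = ∑ c_m(D) z ^ m`; there are no `m`-states for `m` greater than the number of
crossings. -/
noncomputable def Diagram.conway {I : Type} [LinearOrder I] (D : Diagram I) : Polynomial ℤ :=
  ∑ m ∈ Finset.range (Fintype.card D.X + 1), Polynomial.monomial m (D.coeff m)

/-! ### Marks and isotopy -/

/-- The diagrams are the same up to the names of crossings and marks. -/
structure Iso {I : Type} (D D' : Diagram I) where
  eX : D.X ≃ D'.X
  eM : D.M ≃ D'.M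
  kind_eq : ∀ c, D'.kind (eX c) = D.kind c
  next_eq : ∀ a, D'.next (Sum.map id (Sum.map (Prod.map eX id) eM) a) =
    Sum.map id (Sum.map (Prod.map eX id) eM) (D.next a)

/-- Names for the ends in a diagram with one more mark. -/
def splitMark (I P M : Type) : I ⊕ (P ⊕ (M ⊕ Unit)) ≃ (I ⊕ (P ⊕ M)) ⊕ Unit :=
  (Equiv.sumCongr (Equiv.refl I) (Equiv.sumAssoc P M Unit).symm).trans
    (Equiv.sumAssoc I (P ⊕ M) Unit).symm

open Classical in
/-- Put a new mark on the arc that starts at `a`. -/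
noncomputable def Diagram.addMark {I : Type} (D : Diagram I) (a : I ⊕ (D.X × Side ⊕ D.M)) :
    Diagram I where
  X := D.X
  M := D.M ⊕ Unit
  kind := D.kind
  next := (splitMark I (D.X × Side) D.M).trans <|
    (Equiv.swap (Sum.inl a) (Sum.inr ())).trans <|
    (Equiv.sumCongr D.next (Equiv.refl Unit)).trans (splitMark I (D.X × Side) D.M).symm

/-! ### Insertion of a tangle diagram in a small disk -/

/-- The part of a diagram outside a small disk. The boundary of the small disk is crossed inwards
and outwards at points with the names `K`; the arcs of the outer part may start where one leaves the
small disk, and may lead to a point where one enters it. -/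
structure Context (I K : Type) where
  X : Type
  M : Type
  [fintypeX : Fintype X]
  [fintypeM : Fintype M]
  kind : X → Kind
  next : (I ⊕ (X × Side ⊕ M)) ⊕ K ≃ (I ⊕ (X × Side ⊕ M)) ⊕ K

attribute [instance] Context.fintypeX Context.fintypeM

/-- Separation of the ends outside the small disk from those in it; `A` and `B` are two families
of marks on the boundary of the small disk. -/
def splitEnds (I X Y M N A B : Type) :
    I ⊕ ((X ⊕ Y) × Side ⊕ ((M ⊕ N) ⊕ (A ⊕ B))) ≃
      ((I ⊕ (X × Side ⊕ M)) ⊕ B) ⊕ (A ⊕ (Y × Side ⊕ N)) where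
  toFun
    | Sum.inl i => Sum.inl (Sum.inl (Sum.inl i))
    | Sum.inr (Sum.inl (Sum.inl x, s)) => Sum.inl (Sum.inl (Sum.inr (Sum.inl (x, s))))
    | Sum.inr (Sum.inl (Sum.inr y, s)) => Sum.inr (Sum.inr (Sum.inl (y, s)))
    | Sum.inr (Sum.inr (Sum.inl (Sum.inl m))) => Sum.inl (Sum.inl (Sum.inr (Sum.inr m)))
    | Sum.inr (Sum.inr (Sum.inl (Sum.inr m))) => Sum.inr (Sum.inr (Sum.inr m))
    | Sum.inr (Sum.inr (Sum.inr (Sum.inl a))) => Sum.inr (Sum.inl a)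
    | Sum.inr (Sum.inr (Sum.inr (Sum.inr b))) => Sum.inl (Sum.inr b)
  invFun
    | Sum.inl (Sum.inl (Sum.inl i)) => Sum.inl i
    | Sum.inl (Sum.inl (Sum.inr (Sum.inl (x, s)))) => Sum.inr (Sum.inl (Sum.inl x, s))
    | Sum.inr (Sum.inr (Sum.inl (y, s))) => Sum.inr (Sum.inl (Sum.inr y, s))
    | Sum.inl (Sum.inl (Sum.inr (Sum.inr m))) => Sum.inr (Sum.inr (Sum.inl (Sum.inl m)))
    | Sum.inr (Sum.inr (Sum.inr m)) => Sum.inr (Sum.inr (Sum.inl (Sum.inr m)))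
    | Sum.inr (Sum.inl a) => Sum.inr (Sum.inr (Sum.inr (Sum.inl a)))
    | Sum.inl (Sum.inr b) => Sum.inr (Sum.inr (Sum.inr (Sum.inr b)))
  left_inv := by
    rintro (i | ⟨x | y, s⟩ | (m | m) | a | b) <;> rfl
  right_inv := by
    rintro (((i | ⟨x, s⟩ | m) | b) | a | ⟨y, s⟩ | m) <;> rfl

/-- Glue the diagram `T` into the small disk, with a mark at each point where an arc meets the
boundary of the disk: the marks `Sum.inl k` where one enters, the marks `Sum.inr k` where one
leaves. -/
def Context.fill {I K : Type} [Fintype K] (C : Context I K) (T : Diagram K) : Diagram I where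
  X := C.X ⊕ T.X
  M := (C.M ⊕ T.M) ⊕ (K ⊕ K)
  kind := Sum.elim C.kind T.kind
  next := (splitEnds I C.X T.X C.M T.M K K).trans <|
    (Equiv.sumCongr C.next T.next).trans <|
    (splitEnds I C.X T.X C.M T.M K K).symm.trans <|
    Equiv.sumCongr (Equiv.refl I) (Equiv.sumCongr (Equiv.refl _)
      (Equiv.sumCongr (Equiv.refl _) (Equiv.sumComm K K)))

/-! ### The elementary diagrams of the Reidemeister moves -/

/-- Strings without crossings. -/
def trivialDiagram (K : Type) : Diagram K where
  X := Empty
  M := Empty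
  kind := Empty.elim
  next := Equiv.refl _

/-- One string with one crossing, whose outgoing end on the side `s` leads to the incoming end on
the same side. -/
def kink (κ : Kind) (s : Side) : Diagram Unit where
  X := Unit
  M := Empty
  kind := fun _ => κ
  next := Equiv.swap (Sum.inl ()) (Sum.inr (Sum.inl ((), !s)))

/-- Two parallel strings, the left one and the right one, which cross at `false` and then at
`true`; at both crossings the same string is above. -/
def bigonParallel (κ : Kind) : Diagram Side where
  X := Bool
  M := Empty
  kind := fun c => if c then κ.flip else κ
  next :=
    { toFun := fun
        | Sum.inl b => Sum.inr (Sum.inl (false, b))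
        | Sum.inr (Sum.inl (false, b)) => Sum.inr (Sum.inl (true, b))
        | Sum.inr (Sum.inl (true, b)) => Sum.inl b
      invFun := fun
        | Sum.inr (Sum.inl (false, b)) => Sum.inl b
        | Sum.inr (Sum.inl (true, b)) => Sum.inr (Sum.inl (false, b))
        | Sum.inl b => Sum.inr (Sum.inl (true, b))
      left_inv := by rintro (b | ⟨_ | _, b⟩ | ⟨⟨⟩⟩) <;> rfl
      right_inv := by rintro (b | ⟨_ | _, b⟩ | ⟨⟨⟩⟩) <;> rfl }

/-- Two strings in opposite directions, which cross twice; the string `c` comes first to the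
crossing `c` and then to the crossing `!c`. The bigon between the strings is on the side `s` of
both crossings; at both crossings the same string is above. -/
def bigonOpposite (κ : Kind) (s : Side) : Diagram Bool where
  X := Bool
  M := Empty
  kind := fun c => if c then κ.flip else κ
  next :=
    { toFun := fun
        | Sum.inl c => Sum.inr (Sum.inl (c, !s))
        | Sum.inr (Sum.inl (c, t)) => if t = s then Sum.inr (Sum.inl (!c, s)) else Sum.inl (!c)
      invFun := fun
        | Sum.inl c => Sum.inr (Sum.inl (!c, !s))
        | Sum.inr (Sum.inl (c, t)) => if t = s then Sum.inr (Sum.inl (!c, s)) else Sum.inl c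
      left_inv := by cases s <;> rintro (c | ⟨c, _ | _⟩ | ⟨⟨⟩⟩) <;> simp
      right_inv := by cases s <;> rintro (c | ⟨c, _ | _⟩ | ⟨⟨⟩⟩) <;> simp }

/-- Three straight lines form a triangle; going around it counterclockwise, one follows a part of
the line `0`, then of `1`, then of `2`. The line `i` has this direction if `o i` is true and the
other one if not. The lines `i` and `i + 1` meet at the crossing `i`, and this is the side on which
the line `i` comes to it; the line `i + 1` comes to it on the other side. -/
def triangleSide (o : Fin 3 → Bool) (i : Fin 3) : Side :=
  if o i = o (i + 1) then left else right

/-- Three lines which form a triangle, see `triangleSide`. The line `i` passes through the crossing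
`i - 1` and then through the crossing `i` if `o i` is true, and in the other order if not. -/
def triangle (o : Fin 3 → Bool) (κ : Fin 3 → Kind) : Diagram (Fin 3) where
  X := Fin 3
  M := Empty
  kind := κ
  next :=
    { toFun := fun
        | Sum.inl i =>
          if o i then Sum.inr (Sum.inl (i - 1, !triangleSide o (i - 1)))
          else Sum.inr (Sum.inl (i, triangleSide o i))
        | Sum.inr (Sum.inl (j, s)) =>
          if s = triangleSide o j then
            -- on the line `j + 1`
            if o (j + 1) then Sum.inr (Sum.inl (j + 1, triangleSide o (j + 1)))
            else Sum.inl (j + 1)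
          else
            -- on the line `j`
            if o j then Sum.inl j
            else Sum.inr (Sum.inl (j - 1, !triangleSide o (j - 1)))
      invFun := fun
        | Sum.inl i =>
          if o i then Sum.inr (Sum.inl (i, !triangleSide o i))
          else Sum.inr (Sum.inl (i - 1, triangleSide o (i - 1)))
        | Sum.inr (Sum.inl (j, s)) =>
          if s = triangleSide o j then
            -- on the line `j`
            if o j then Sum.inr (Sum.inl (j - 1, triangleSide o (j - 1)))
            else Sum.inl j
          else
            -- on the line `j + 1`
            if o (j + 1) then Sum.inl (j + 1)
            else Sum.inr (Sum.inl (j + 1, !triangleSide o (j + 1)))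
      left_inv := by revert o; unfold Function.LeftInverse; decide
      right_inv := by revert o; unfold Function.RightInverse Function.LeftInverse; decide }

/-- The kinds of crossings at which a line of the triangle may be moved past the crossing of the
other two lines: either all three crossings are real, and the lines lie one above the other
(`h` is the height), or at most one crossing is real. -/
def TriangleAdmissible (o : Fin 3 → Bool) (κ : Fin 3 → Kind) : Prop :=
  (∃ h : Equiv.Perm (Fin 3), ∀ i,
      κ i = if h (i + 1) < h i ↔ triangleSide o i = left then Kind.pos else Kind.neg) ∨
    ∃ j, ∀ i, i ≠ j → κ i = Kind.virt

/-- The Reidemeister moves, in all orientations: the real ones, the virtual ones, and the mixed one.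
The third move reverses the order of the two crossings on each of the lines. -/
inductive Elementary : {K : Type} → Diagram K → Diagram K → Prop where
  | first (κ : Kind) (s : Side) : Elementary (kink κ s) (trivialDiagram Unit)
  | secondParallel (κ : Kind) : Elementary (bigonParallel κ) (trivialDiagram Side)
  | secondOpposite (κ : Kind) (s : Side) : Elementary (bigonOpposite κ s) (trivialDiagram Bool)
  | third (o : Fin 3 → Bool) (κ : Fin 3 → Kind) (h : TriangleAdmissible o κ) :
      Elementary (triangle o κ) (triangle (fun i => !o i) κ)

/-- One step between diagrams: an isotopy of the disk, a new mark on an arc, or a Reidemeister move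
in a small disk. -/
inductive Move {I : Type} : Diagram I → Diagram I → Prop where
  | iso {D D' : Diagram I} (e : Iso D D') : Move D D'
  | addMark (D : Diagram I) (a : I ⊕ (D.X × Side ⊕ D.M)) : Move D (D.addMark a)
  | reidemeister {K : Type} [Fintype K] (C : Context I K) {T T' : Diagram K}
      (h : Elementary T T') : Move (C.fill T) (C.fill T')

/-! ### Ordered tangles

The `k`-th input and the `k`-th output, for `k` in `Fin n`, carry the numbers `2 k + 1` and
`2 k + 2` of the ordering. -/

/-- Diagrams of ordered virtual tangles with `n` strings. -/
def VirtualDiagram {n : ℕ} (pos : Fin n ⊕ Fin n ≃ Fin (2 * n)) : Type 1 :=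
  {D : Diagram (Fin n) // D.IsPlane pos}

/-- Diagrams of ordered classical tangles with `n` strings. -/
def ClassicalDiagram {n : ℕ} (pos : Fin n ⊕ Fin n ≃ Fin (2 * n)) : Type 1 :=
  {D : Diagram (Fin n) // D.IsPlane pos ∧ D.IsClassical}

/-- Ordered virtual tangles: the classes of the equivalence relation generated by the moves. -/
def VirtualTangle {n : ℕ} (pos : Fin n ⊕ Fin n ≃ Fin (2 * n)) : Type 1 :=
  Quot fun D D' : VirtualDiagram pos => Move D.1 D'.1

/-- Ordered classical tangles: the classes of the equivalence relation generated by those moves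
that do not leave the classical diagrams. -/
def ClassicalTangle {n : ℕ} (pos : Fin n ⊕ Fin n ≃ Fin (2 * n)) : Type 1 :=
  Quot fun D D' : ClassicalDiagram pos => Move D.1 D'.1

/-- The virtual tangle with the given diagram. -/
def VirtualTangle.mk {n : ℕ} {pos : Fin n ⊕ Fin n ≃ Fin (2 * n)} (D : VirtualDiagram pos) :
    VirtualTangle pos :=
  Quot.mk _ D

/-- The classical tangle with the given diagram. -/
def ClassicalTangle.mk {n : ℕ} {pos : Fin n ⊕ Fin n ≃ Fin (2 * n)} (D : ClassicalDiagram pos) :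
    ClassicalTangle pos :=
  Quot.mk _ D

end OrderedTangle

/-! A Reidemeister move changes a diagram only inside a small disk. Split a set of crossings into a
part `S` outside the disk and a part `S'` inside. The outside sees of the smoothed interior only a
permutation `σ`, which joins the entries of the disk to its exits; the interior sees of the outside
only the order in which its strings are entered. So a state is descending iff its outer part is
descending after the disk is filled with crossingless strings joined by `σ`, and its inner part is
descending for the order of entry (`Context.descendsVia_fill_iff`). The polynomial becomes a sum
over `S` and `σ` of an outer weight times a local `stateSum` (`Context.conway_fill`), and a move
preserves it if both small diagrams have equal local sums for each `σ` and each total order of the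
entries (`Context.conway_fill_congr`).

This is a finite problem. Smoothing a kink splits off a circle. Smoothing both crossings of a bigon
gives a circle (opposite strings) or contradictory order conditions (parallel strings), while the
two single smoothings have the same `σ`, the same order condition and opposite signs, and cancel.
The third move is checked over all directions, admissible kinds and orders. All these checks are
evaluated by the kernel, from a computable description of states that `Diagram.coeff_stateSum`
proves correct.

The technical device is the flow: a label of each place by a string and a time, subject to a
condition on single steps only. The existence of a flow replaces statements about iterated walks;
flows can be pulled back, extended, restricted and composed, and any flow decides whether a state is
descending (`IsFlow.descendsVia_iff`). -/

namespace OrderedTangle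

/-! ### Flows

A permutation of `I ⊕ P` describes strings which start and end at `I` and pass through the places
`P`. A flow tells for each place on which string and at what time it is passed. -/

section Flow

variable {I P L : Type}

/-- One step along a string; one stops at outputs. -/
def advance (f : I ⊕ P → I ⊕ P) : I ⊕ P → I ⊕ P
  | Sum.inl i => Sum.inl i
  | Sum.inr p => f (Sum.inr p)

/-- The place that one reaches at time `m` on the string that starts at `i`. -/
def route (f : I ⊕ P → I ⊕ P) (i : I) (m : ℕ) : I ⊕ P :=
  (advance f)^[m] (f (Sum.inl i))

/-- The compatibility of `σ`, `a` and `t` with a step from the first place to the second one. -/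
def Linked [LT L] (σ : Equiv.Perm I) (a : P → I) (t : P → L) : I ⊕ P → I ⊕ P → Prop
  | Sum.inl i, Sum.inl j => σ i = j
  | Sum.inl i, Sum.inr p => a p = i
  | Sum.inr p, Sum.inl j => σ (a p) = j
  | Sum.inr p, Sum.inr q => a q = a p ∧ t p < t q

/-- The string from `i` leads to `σ i`, and the place `p` is passed on the string from `a p`, at
the time `t p`. -/
def IsFlow [LT L] (f : Equiv.Perm (I ⊕ P)) (σ : Equiv.Perm I) (a : P → I) (t : P → L) : Prop :=
  ∀ x, Linked σ a t x (f x)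

theorem route_zero (f : I ⊕ P → I ⊕ P) (i : I) : route f i 0 = f (Sum.inl i) := rfl

theorem route_succ (f : I ⊕ P → I ⊕ P) (i : I) (m : ℕ) :
    route f i (m + 1) = advance f (route f i m) :=
  Function.iterate_succ_apply' _ _ _

theorem route_succ_of_eq_inr {f : I ⊕ P → I ⊕ P} {i : I} {m : ℕ} {p : P}
    (h : route f i m = Sum.inr p) : route f i (m + 1) = f (Sum.inr p) := by
  rw [route_succ, h, advance]

theorem route_eq_inl_of_le {f : I ⊕ P → I ⊕ P} {i j : I} {m n : ℕ}
    (h : route f i m = Sum.inl j) (hmn : m ≤ n) : route f i n = Sum.inl j := by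
  induction n, hmn using Nat.le_induction with
  | base => exact h
  | succ n _ ih => rw [route_succ, ih, advance]

theorem route_inl_unique {f : I ⊕ P → I ⊕ P} {i j j' : I} {m n : ℕ}
    (h : route f i m = Sum.inl j) (h' : route f i n = Sum.inl j') : j = j' := by
  have h1 := route_eq_inl_of_le h (le_max_left m n)
  have h2 := route_eq_inl_of_le h' (le_max_right m n)
  exact Sum.inl_injective (h1.symm.trans h2)

theorem exists_of_route_succ_eq_inr {f : I ⊕ P → I ⊕ P} {i : I} {m : ℕ} {q : P}
    (h : route f i (m + 1) = Sum.inr q) :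
    ∃ p, route f i m = Sum.inr p ∧ f (Sum.inr p) = Sum.inr q := by
  rw [route_succ] at h
  cases hx : route f i m with
  | inl j => rw [hx, advance] at h; exact absurd h Sum.inl_ne_inr
  | inr p => rw [hx, advance] at h; exact ⟨p, rfl, h⟩

/-- Injectivity of `f` allows both routes to be run backwards together: a place reached at time `0`
comes from an input, a place reached later comes from a place, so both routes arrive at their inputs
at once. In particular no route repeats a place. -/
theorem route_inr_unique (f : Equiv.Perm (I ⊕ P)) {i j : I} {m n : ℕ} {p : P}
    (h : route f i m = Sum.inr p) (h' : route f j n = Sum.inr p) : i = j ∧ m = n := by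
  induction m generalizing n p with
  | zero =>
    cases n with
    | zero => exact ⟨Sum.inl_injective (f.injective (h.trans h'.symm)), rfl⟩
    | succ n =>
      obtain ⟨q, -, hq⟩ := exists_of_route_succ_eq_inr h'
      exact absurd (f.injective (h.trans hq.symm)) Sum.inl_ne_inr
  | succ m ih =>
    obtain ⟨r, hr, hf⟩ := exists_of_route_succ_eq_inr h
    cases n with
    | zero => exact absurd (f.injective (hf.trans h'.symm)) Sum.inr_ne_inl
    | succ n =>
      obtain ⟨q, hq, hf'⟩ := exists_of_route_succ_eq_inr h'
      obtain rfl := Sum.inr_injective (f.injective (hf.trans hf'.symm))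
      obtain ⟨h1, h2⟩ := ih hr hq
      exact ⟨h1, congrArg _ h2⟩

/-- The place `p` is passed before the place `q` if the strings are ordered by `R`. -/
def RouteBefore (f : I ⊕ P → I ⊕ P) (R : I → I → Prop) (p q : P) : Prop :=
  ∀ i m i' m', route f i m = Sum.inr p → route f i' m' = Sum.inr q → R i i' ∨ i = i' ∧ m < m'

/-- The route itself supplies the labels: the input from which a place is reached, and the number of
steps. -/
theorem exists_isFlow_of_route (f : Equiv.Perm (I ⊕ P)) {σ : Equiv.Perm I}
    (hσ : ∀ i, ∃ m, route f i m = Sum.inl (σ i)) (h : ∀ p, ∃ i m, route f i m = Sum.inr p) :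
    ∃ (a : P → I) (t : P → ℕ), IsFlow f σ a t := by
  choose a t hat using h
  choose e he using hσ
  refine ⟨a, t, fun x => ?_⟩
  cases x with
  | inl i =>
    cases hx : f (Sum.inl i) with
    | inl j => exact route_inl_unique (he i) (n := 0) hx
    | inr p => exact (route_inr_unique f (hat p) (n := 0) hx).1
  | inr p =>
    have hp := route_succ_of_eq_inr (hat p)
    cases hx : f (Sum.inr p) with
    | inl j => exact route_inl_unique (he _) (hp.trans hx)
    | inr q =>
      obtain ⟨h1, h2⟩ := route_inr_unique f (hat q) (hp.trans hx)
      exact ⟨h1, by omega⟩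

theorem wellFounded_time [Finite P] [Preorder L] (t : P → L) :
    WellFounded fun p q => t p < t q :=
  haveI : IsTrans P fun p q => t p < t q := ⟨fun _ _ _ => lt_trans⟩
  haveI : Std.Irrefl fun p q : P => t p < t q := ⟨fun p => lt_irrefl (t p)⟩
  Finite.wellFounded_of_trans_of_irrefl _

/-- There is a flow if there are no closed components. -/
theorem exists_isFlow [Finite I] [Finite P] [Preorder L] (f : Equiv.Perm (I ⊕ P)) (t : P → L)
    (ht : ∀ p q, f (Sum.inr p) = Sum.inr q → t p < t q) :
    ∃ (σ : Equiv.Perm I) (a : P → I) (s : P → ℕ), IsFlow f σ a s := by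
  -- Backwards from `p` the time drops, so by well-foundedness the way back ends at an input.
  have hP (p : P) : ∃ i m, route f i m = Sum.inr p := by
    induction p using (wellFounded_time t).induction with
    | _ p ih =>
    obtain ⟨x, hx⟩ := f.surjective (Sum.inr p)
    cases x with
    | inl i => exact ⟨i, 0, hx⟩
    | inr q =>
      obtain ⟨i, m, h⟩ := ih q (ht q p hx)
      exact ⟨i, m + 1, (route_succ_of_eq_inr h).trans hx⟩
  have hI (j : I) : ∃ i m, route f i m = Sum.inl j := by
    obtain ⟨x, hx⟩ := f.surjective (Sum.inl j)
    cases x with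
    | inl i => exact ⟨i, 0, hx⟩
    | inr q =>
      obtain ⟨i, m, h⟩ := hP q
      exact ⟨i, m + 1, (route_succ_of_eq_inr h).trans hx⟩
  -- `τ` sends an output to the input of its string. A route ends at one output only, so `τ` is
  -- injective, hence bijective by finiteness; the permutation of the flow is its inverse.
  choose τ n hτ using hI
  have hinj : Function.Injective τ := fun j j' hj => by
    have h := hτ j
    rw [hj] at h
    exact route_inl_unique h (hτ j')
  let τ' := Equiv.ofBijective τ (Finite.injective_iff_bijective.1 hinj)
  obtain ⟨a, s, h⟩ := exists_isFlow_of_route (σ := τ'.symm) f (fun i => ⟨n (τ'.symm i), by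
    have := hτ (τ'.symm i)
    rwa [show τ (τ'.symm i) = i from τ'.apply_symm_apply i] at this⟩) hP
  exact ⟨_, a, s, h⟩

/-! ### Routes recovered from a flow -/

namespace IsFlow

variable {f : Equiv.Perm (I ⊕ P)} {σ : Equiv.Perm I} {a : P → I} {t : P → L}

section Preorder

variable [Preorder L]

/-- Induction on time: the predecessor of a place is an input, or a place on the same string at an
earlier time. -/
theorem induction [Finite P] (h : IsFlow f σ a t) {Q : I → P → Prop}
    (h0 : ∀ i p, f (Sum.inl i) = Sum.inr p → Q i p)
    (h1 : ∀ p q, f (Sum.inr p) = Sum.inr q → Q (a p) p → Q (a p) q) (p : P) : Q (a p) p := by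
  induction p using (wellFounded_time t).induction with
  | _ p ih =>
  obtain ⟨x, hx⟩ := f.surjective (Sum.inr p)
  have := h x
  rw [hx] at this
  cases x with
  | inl i => rw [show a p = i from this]; exact h0 i p hx
  | inr q =>
    obtain ⟨h2, h3⟩ : a p = a q ∧ t q < t p := this
    rw [h2]
    exact h1 q p hx (ih q h3)

theorem exists_route [Finite P] (h : IsFlow f σ a t) (p : P) :
    ∃ m, route f (a p) m = Sum.inr p :=
  h.induction (Q := fun i p => ∃ m, route f i m = Sum.inr p) (fun _ _ hx => ⟨0, hx⟩)
    (fun _ _ hx ⟨m, hm⟩ => ⟨m + 1, (route_succ_of_eq_inr hm).trans hx⟩) p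

theorem exists_route_inl [Finite P] (h : IsFlow f σ a t) (i : I) :
    ∃ m, route f i m = Sum.inl (σ i) := by
  obtain ⟨x, hx⟩ := f.surjective (Sum.inl (σ i))
  have := h x
  rw [hx] at this
  cases x with
  | inl j =>
    obtain rfl := σ.injective (show σ j = σ i from this)
    exact ⟨0, hx⟩
  | inr q =>
    obtain rfl := σ.injective (show σ (a q) = σ i from this)
    obtain ⟨m, hm⟩ := h.exists_route q
    exact ⟨m + 1, (route_succ_of_eq_inr hm).trans hx⟩

theorem eq_of_route (h : IsFlow f σ a t) {i : I} {m : ℕ} {p : P}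
    (hp : route f i m = Sum.inr p) : a p = i := by
  induction m generalizing p with
  | zero =>
    have := h (Sum.inl i)
    rwa [show f (Sum.inl i) = Sum.inr p from hp] at this
  | succ m ih =>
    obtain ⟨q, hq, hx⟩ := exists_of_route_succ_eq_inr hp
    have := h (Sum.inr q)
    rw [hx] at this
    exact (show a p = a q from this.1).trans (ih hq)

theorem lt_of_route (h : IsFlow f σ a t) {i : I} {m n : ℕ} {p q : P}
    (hp : route f i m = Sum.inr p) (hq : route f i n = Sum.inr q) (hmn : m < n) : t p < t q := by
  induction n generalizing q with
  | zero => omega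
  | succ n ih =>
    obtain ⟨r, hr, hx⟩ := exists_of_route_succ_eq_inr hq
    have := h (Sum.inr r)
    rw [hx] at this
    have hlt : t r < t q := this.2
    rcases Nat.lt_succ_iff_lt_or_eq.1 hmn with h' | rfl
    · exact (ih hr h').trans hlt
    · rwa [Sum.inr_injective (hp.symm.trans hr)]

theorem lt_iff_of_route (h : IsFlow f σ a t) {i : I} {m n : ℕ} {p q : P}
    (hp : route f i m = Sum.inr p) (hq : route f i n = Sum.inr q) : t p < t q ↔ m < n := by
  refine ⟨fun hlt => ?_, h.lt_of_route hp hq⟩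
  rcases lt_trichotomy m n with h' | rfl | h'
  · exact h'
  · rw [Sum.inr_injective (hp.symm.trans hq)] at hlt
    exact absurd hlt (lt_irrefl _)
  · exact absurd (h.lt_of_route hq hp h') hlt.asymm

/-- Each place lies on exactly one route, at exactly one step, and the time of a flow increases
along it; so any flow, with times in any preorder, gives the same comparison as the count of steps.
-/
theorem routeBefore_iff [Finite P] (h : IsFlow f σ a t) (R : I → I → Prop) (p q : P) :
    RouteBefore f R p q ↔ R (a p) (a q) ∨ a p = a q ∧ t p < t q := by
  obtain ⟨m, hm⟩ := h.exists_route p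
  obtain ⟨n, hn⟩ := h.exists_route q
  constructor
  · intro hb
    refine (hb _ _ _ _ hm hn).imp_right fun ⟨h1, h2⟩ => ⟨h1, ?_⟩
    rw [← h1] at hn
    exact h.lt_of_route hm hn h2
  · rintro hb i m i' m' h1 h2
    obtain rfl := h.eq_of_route h1
    obtain rfl := h.eq_of_route h2
    refine hb.imp_right fun ⟨h3, h4⟩ => ⟨h3, ?_⟩
    rw [← h3] at h2
    exact (h.lt_iff_of_route h1 h2).1 h4

theorem perm_unique [Finite P] {L' : Type} [Preorder L'] (h : IsFlow f σ a t)
    {σ' : Equiv.Perm I} {a' : P → I} {t' : P → L'} (h' : IsFlow f σ' a' t') : σ = σ' := by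
  ext i
  obtain ⟨m, hm⟩ := h.exists_route_inl i
  obtain ⟨n, hn⟩ := h'.exists_route_inl i
  exact route_inl_unique hm hn

end Preorder

/-- Two places on one route are reached at comparable steps, and different steps have different
times. This later makes the order of entry into a small disk strict and total. -/
theorem place_ext [Finite P] [LinearOrder L] (h : IsFlow f σ a t) {p q : P} (ha : a p = a q)
    (ht : t p = t q) : p = q := by
  obtain ⟨m, hm⟩ := h.exists_route p
  obtain ⟨n, hn⟩ := h.exists_route q
  rw [ha] at hm
  rcases lt_trichotomy m n with h' | rfl | h'
  · exact absurd ht (h.lt_of_route hm hn h').ne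
  · exact Sum.inr_injective (hm.symm.trans hn)
  · exact absurd ht (h.lt_of_route hn hm h').ne'

end IsFlow

end Flow

/-! ### States of diagrams as flows -/

section States

variable {I : Type}

/-- The places of a diagram: incoming ends of crossings, and marks. -/
abbrev Diagram.Place (D : Diagram I) : Type := D.X × Side ⊕ D.M

theorem Diagram.turn_of_mem (D : Diagram I) {S : Finset D.X} {c : D.X} (h : c ∈ S) (s : Side) :
    D.turn S (Sum.inl (c, s)) = Sum.inl (c, s) := by
  simp [Diagram.turn, h]

theorem Diagram.turn_of_notMem (D : Diagram I) {S : Finset D.X} {c : D.X} (h : c ∉ S)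
    (s : Side) : D.turn S (Sum.inl (c, s)) = Sum.inl (c, !s) := by
  simp [Diagram.turn, h]

theorem Diagram.turn_turn (D : Diagram I) (S : Finset D.X) (p : D.Place) :
    D.turn S (D.turn S p) = p := by
  rcases p with ⟨c, s⟩ | m
  · by_cases h : c ∈ S <;> simp [Diagram.turn, h]
  · rfl

/-- The strings of `D(S)` as a permutation: through a vertex and along the arc that follows. -/
noncomputable def Diagram.pass (D : Diagram I) (S : Finset D.X) : Equiv.Perm (I ⊕ D.Place) :=
  (Equiv.sumCongr (Equiv.refl I)
    (Function.Involutive.toPerm (D.turn S) (D.turn_turn S))).trans D.next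

theorem Diagram.pass_inl (D : Diagram I) (S : Finset D.X) (i : I) :
    D.pass S (Sum.inl i) = D.next (Sum.inl i) := rfl

theorem Diagram.pass_inr (D : Diagram I) (S : Finset D.X) (p : D.Place) :
    D.pass S (Sum.inr p) = D.next (Sum.inr (D.turn S p)) := rfl

theorem Diagram.walk_eq_route (D : Diagram I) (S : Finset D.X) : D.walk S = route (D.pass S) := by
  have h : D.step S = advance (D.pass S) := by
    funext x
    cases x <;> rfl
  funext i m
  simp only [Diagram.walk, route, h]
  rfl

/-- A descending state whose string from the input `i` leads to the output `σ i`, where the strings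
are ordered by `R`. -/
def Diagram.DescendsVia (D : Diagram I) (σ : Equiv.Perm I) (R : I → I → Prop)
    (S : Finset D.X) : Prop :=
  (∀ c ∈ S, D.kind c ≠ Kind.virt) ∧
    ((∀ i, ∃ m, route (D.pass S) i m = Sum.inl (σ i)) ∧
      ∀ p, ∃ i m, route (D.pass S) i m = Sum.inr p) ∧
    ∀ c ∈ S, RouteBefore (D.pass S) R (Sum.inl (c, (D.kind c).over))
      (Sum.inl (c, !(D.kind c).over))

theorem Diagram.isDescending_iff [LinearOrder I] (D : Diagram I) (S : Finset D.X) :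
    D.IsDescending S ↔ D.DescendsVia 1 (· < ·) S := by
  rw [Diagram.IsDescending, Diagram.IsCoherent, Diagram.walk_eq_route]
  rfl

/-- The conditions on the crossings of a descending state, in terms of a flow. -/
def Diagram.DescendsAlong {L : Type} [LT L] (D : Diagram I) (R : I → I → Prop)
    (a : D.Place → I) (t : D.Place → L) (S : Finset D.X) : Prop :=
  ∀ c ∈ S, D.kind c ≠ Kind.virt ∧
    (R (a (Sum.inl (c, (D.kind c).over))) (a (Sum.inl (c, !(D.kind c).over))) ∨
      a (Sum.inl (c, (D.kind c).over)) = a (Sum.inl (c, !(D.kind c).over)) ∧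
      t (Sum.inl (c, (D.kind c).over)) < t (Sum.inl (c, !(D.kind c).over)))

theorem Diagram.DescendsVia.exists_isFlow {D : Diagram I} {σ : Equiv.Perm I} {R : I → I → Prop}
    {S : Finset D.X} (h : D.DescendsVia σ R S) :
    ∃ (a : D.Place → I) (t : D.Place → ℕ), IsFlow (D.pass S) σ a t :=
  exists_isFlow_of_route _ h.2.1.1 h.2.1.2

theorem Diagram.DescendsVia.perm_unique {D : Diagram I} {S : Finset D.X} {σ σ' : Equiv.Perm I}
    {R R' : I → I → Prop} (h : D.DescendsVia σ R S) (h' : D.DescendsVia σ' R' S) : σ = σ' := by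
  obtain ⟨a, t, hf⟩ := h.exists_isFlow
  obtain ⟨a', t', hf'⟩ := h'.exists_isFlow
  exact hf.perm_unique hf'

/-- Once a flow is known, coherence is automatic, and only the conditions on the smoothed crossings
remain. -/
theorem IsFlow.descendsVia_iff {L : Type} [Preorder L] {D : Diagram I} {σ : Equiv.Perm I}
    {S : Finset D.X} {a : D.Place → I} {t : D.Place → L} (h : IsFlow (D.pass S) σ a t)
    (R : I → I → Prop) : D.DescendsVia σ R S ↔ D.DescendsAlong R a t S := by
  have h1 : (∀ i, ∃ m, route (D.pass S) i m = Sum.inl (σ i)) ∧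
      ∀ p, ∃ i m, route (D.pass S) i m = Sum.inr p :=
    ⟨h.exists_route_inl, fun p => ⟨_, h.exists_route p⟩⟩
  simp only [Diagram.DescendsVia, Diagram.DescendsAlong, h.routeBefore_iff]
  exact ⟨fun h2 c hc => ⟨h2.1 c hc, h2.2.2 c hc⟩,
    fun h2 => ⟨fun c hc => (h2 c hc).1, h1, fun c hc => (h2 c hc).2⟩⟩

open Classical in
/-- The sum over the descending states, see `DescendsVia`. -/
noncomputable def Diagram.stateSum (D : Diagram I) (σ : Equiv.Perm I) (R : I → I → Prop) :
    Polynomial ℤ :=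
  ∑ S : Finset D.X, if D.DescendsVia σ R S then
    ∏ c ∈ S, (Polynomial.C (D.kind c).sign * Polynomial.X) else 0

theorem Diagram.prod_sign (D : Diagram I) (S : Finset D.X) :
    ∏ c ∈ S, (Polynomial.C (D.kind c).sign * Polynomial.X) =
      Polynomial.monomial S.card (∏ c ∈ S, (D.kind c).sign) := by
  rw [Finset.prod_mul_distrib, Finset.prod_const, ← map_prod, Polynomial.C_mul_X_pow_eq_monomial]

theorem Diagram.conway_eq_stateSum [LinearOrder I] (D : Diagram I) :
    D.conway = D.stateSum 1 (· < ·) := by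
  classical
  simp only [Diagram.conway, Diagram.coeff, Diagram.stateSum, map_sum, ← D.isDescending_iff,
    D.prod_sign, Finset.sum_filter, ite_and]
  rw [Finset.sum_comm]
  refine Finset.sum_congr rfl fun S _ => ?_
  -- After the exchange of sums, a state contributes only in the degree equal to its number of
  -- crossings.
  rw [Finset.sum_eq_single S.card]
  · split_ifs <;> simp_all
  · intro m _ hm
    simp [hm.symm]
  · intro h
    exact absurd (Finset.mem_range.2 (Nat.lt_succ_of_le S.card_le_univ)) h

theorem Diagram.conway_congr [LinearOrder I] {D D' : Diagram I} (e : D.X ≃ D'.X)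
    (hk : ∀ c, D'.kind (e c) = D.kind c)
    (h : ∀ S : Finset D.X, D.DescendsVia 1 (· < ·) S ↔
      D'.DescendsVia 1 (· < ·) (S.map e.toEmbedding)) : D.conway = D'.conway := by
  classical
  rw [D.conway_eq_stateSum, D'.conway_eq_stateSum, Diagram.stateSum, Diagram.stateSum]
  refine Fintype.sum_equiv (Equiv.finsetCongr e) _ _ fun S => ?_
  simp only [Equiv.finsetCongr_apply, ← h S, Finset.prod_map, Equiv.coe_toEmbedding, hk]

end States

/-! ### Isotopies and marks -/

section Isotopy

variable {I : Type}

/-- The correspondence of places. -/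
def Iso.place {D D' : Diagram I} (e : Iso D D') : D.Place ≃ D'.Place :=
  Equiv.sumCongr (Equiv.prodCongr e.eX (Equiv.refl Side)) e.eM

theorem Iso.pass_map {D D' : Diagram I} (e : Iso D D') (S : Finset D.X) (x : I ⊕ D.Place) :
    D'.pass (S.map e.eX.toEmbedding) (Sum.map id e.place x) = Sum.map id e.place (D.pass S x) := by
  classical
  rcases x with i | ⟨c, s⟩ | m
  · exact e.next_eq (Sum.inl i)
  · have h : D'.turn (S.map e.eX.toEmbedding) (e.place (Sum.inl (c, s))) =
        e.place (D.turn S (Sum.inl (c, s))) := by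
      by_cases hc : c ∈ S <;> simp [Diagram.turn, Iso.place, hc]
    rw [Sum.map_inr, Diagram.pass_inr, h]
    exact e.next_eq (Sum.inr (D.turn S (Sum.inl (c, s))))
  · exact e.next_eq (Sum.inr (Sum.inr m))

theorem Iso.isFlow {L : Type} [LT L] {D D' : Diagram I} (e : Iso D D') {S : Finset D.X}
    {σ : Equiv.Perm I} {a : D'.Place → I} {t : D'.Place → L}
    (h : IsFlow (D'.pass (S.map e.eX.toEmbedding)) σ a t) :
    IsFlow (D.pass S) σ (a ∘ e.place) (t ∘ e.place) := by
  intro x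
  have h' := h (Sum.map id e.place x)
  rw [e.pass_map] at h'
  generalize D.pass S x = y at h'
  cases x <;> cases y <;> exact h'

/-- The inverse correspondence. -/
def Iso.symm {D D' : Diagram I} (e : Iso D D') : Iso D' D where
  eX := e.eX.symm
  eM := e.eM.symm
  kind_eq c := by rw [← e.kind_eq, Equiv.apply_symm_apply]
  next_eq a := by
    have h (b : I ⊕ D'.Place) : Sum.map id e.place (Sum.map id e.place.symm b) = b := by
      cases b <;> simp
    have h' (b : I ⊕ D.Place) : Sum.map id e.place.symm (Sum.map id e.place b) = b := by
      cases b <;> simp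
    have := e.next_eq (Sum.map id e.place.symm a)
    change D'.next (Sum.map id e.place _) = Sum.map id e.place _ at this
    rw [h] at this
    change D.next (Sum.map id e.place.symm a) = Sum.map id e.place.symm _
    rw [this, h']

theorem Iso.descendsVia {D D' : Diagram I} (e : Iso D D') {S : Finset D.X} {σ : Equiv.Perm I}
    {R : I → I → Prop} (h : D'.DescendsVia σ R (S.map e.eX.toEmbedding)) :
    D.DescendsVia σ R S := by
  obtain ⟨a, t, hf⟩ := h.exists_isFlow
  rw [(e.isFlow hf).descendsVia_iff]
  intro c hc
  rw [hf.descendsVia_iff] at h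
  have := h (e.eX c) (Finset.mem_map_of_mem _ hc)
  rw [e.kind_eq] at this
  exact this

theorem Iso.conway_eq [LinearOrder I] {D D' : Diagram I} (e : Iso D D') :
    D.conway = D'.conway := by
  refine Diagram.conway_congr e.eX e.kind_eq fun S => ⟨fun h => e.symm.descendsVia ?_,
    e.descendsVia⟩
  convert h
  ext c
  simp [Iso.symm]

/-! ### Invariance under the addition of marks -/

/-- The inclusion of the old places in the diagram with one more mark. -/
def Diagram.oldPlace (D : Diagram I) (a : I ⊕ D.Place) : D.Place → (D.addMark a).Place :=
  Sum.map id Sum.inl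

/-- The new mark. -/
def Diagram.newMark (D : Diagram I) (a : I ⊕ D.Place) : (D.addMark a).Place :=
  Sum.inr (Sum.inr ())

theorem splitMark_oldPlace (D : Diagram I) (a b : I ⊕ D.Place) :
    splitMark I (D.X × Side) D.M (Sum.map id (D.oldPlace a) b) = Sum.inl b := by
  rcases b with i | p | m <;> rfl

theorem splitMark_symm_inl (D : Diagram I) (a b : I ⊕ D.Place) :
    (splitMark I (D.X × Side) D.M).symm (Sum.inl b) = Sum.map id (D.oldPlace a) b := by
  rcases b with i | p | m <;> rfl

theorem Diagram.addMark_next_self (D : Diagram I) (a : I ⊕ D.Place) :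
    (D.addMark a).next (Sum.map id (D.oldPlace a) a) = Sum.inr (D.newMark a) := by
  classical
  change (splitMark I (D.X × Side) D.M).symm (Equiv.sumCongr D.next (Equiv.refl Unit)
    (Equiv.swap _ _ (splitMark I (D.X × Side) D.M (Sum.map id (D.oldPlace a) a)))) = _
  rw [splitMark_oldPlace, Equiv.swap_apply_left]
  rfl

theorem Diagram.addMark_next_newMark (D : Diagram I) (a : I ⊕ D.Place) :
    (D.addMark a).next (Sum.inr (D.newMark a)) = Sum.map id (D.oldPlace a) (D.next a) := by
  classical
  change (splitMark I (D.X × Side) D.M).symm (Equiv.sumCongr D.next (Equiv.refl Unit)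
    (Equiv.swap (Sum.inl a) (Sum.inr ()) (Sum.inr ()))) = _
  rw [Equiv.swap_apply_right]
  exact splitMark_symm_inl D a (D.next a)

theorem Diagram.addMark_next_of_ne (D : Diagram I) {a b : I ⊕ D.Place} (h : b ≠ a) :
    (D.addMark a).next (Sum.map id (D.oldPlace a) b) = Sum.map id (D.oldPlace a) (D.next b) := by
  classical
  change (splitMark I (D.X × Side) D.M).symm (Equiv.sumCongr D.next (Equiv.refl Unit)
    (Equiv.swap (Sum.inl a) (Sum.inr ()) (splitMark I (D.X × Side) D.M
      (Sum.map id (D.oldPlace a) b)))) = _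
  rw [splitMark_oldPlace, Equiv.swap_apply_of_ne_of_ne (by simpa using h) (by simp)]
  exact splitMark_symm_inl D a (D.next b)

theorem Diagram.addMark_pass_oldPlace (D : Diagram I) (a : I ⊕ D.Place) (S : Finset D.X)
    (x : I ⊕ D.Place) :
    (D.addMark a).pass S (Sum.map id (D.oldPlace a) x) =
      (D.addMark a).next (Sum.map id (D.oldPlace a) (Sum.map id (D.turn S) x)) := by
  rcases x with i | p | m <;> rfl

theorem Diagram.addMark_pass_newMark (D : Diagram I) (a : I ⊕ D.Place) (S : Finset D.X) :
    (D.addMark a).pass S (Sum.inr (D.newMark a)) = Sum.map id (D.oldPlace a) (D.next a) :=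
  D.addMark_next_newMark a

theorem Diagram.pass_eq_next (D : Diagram I) (S : Finset D.X) (x : I ⊕ D.Place) :
    D.pass S x = D.next (Sum.map id (D.turn S) x) := by
  cases x <;> rfl

/-- Forgetting the mark merges the two steps through it into one; the time still increases, by
transitivity. -/
theorem IsFlow.of_addMark {L : Type} [Preorder L] {D : Diagram I} {a : I ⊕ D.Place}
    {S : Finset D.X} {σ : Equiv.Perm I} {b : (D.addMark a).Place → I}
    {t : (D.addMark a).Place → L} (h : IsFlow ((D.addMark a).pass S) σ b t) :
    IsFlow (D.pass S) σ (b ∘ D.oldPlace a) (t ∘ D.oldPlace a) := by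
  intro x
  have h1 := h (Sum.map id (D.oldPlace a) x)
  rw [D.addMark_pass_oldPlace] at h1
  rw [D.pass_eq_next]
  by_cases hx : Sum.map id (D.turn S) x = a
  · have h2 := h (Sum.inr (D.newMark a))
    rw [D.addMark_pass_newMark] at h2
    rw [hx, D.addMark_next_self] at h1
    rw [hx]
    generalize D.next a = y at h2
    cases x <;> cases y <;> simp_all [Linked]
    exact h1.2.trans h2.2
  · rw [D.addMark_next_of_ne hx] at h1
    generalize D.next _ = y at h1
    cases x <;> cases y <;> exact h1

/-- The extension of a function on the old places. -/
def Diagram.extendMark {α : Type} (D : Diagram I) (a : I ⊕ D.Place) (u : D.Place → α) (v : α) :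
    (D.addMark a).Place → α
  | Sum.inl p => u (Sum.inl p)
  | Sum.inr (Sum.inl m) => u (Sum.inr m)
  | Sum.inr (Sum.inr ()) => v

theorem Diagram.extendMark_oldPlace {α : Type} (D : Diagram I) (a : I ⊕ D.Place)
    (u : D.Place → α) (v : α) (p : D.Place) : D.extendMark a u v (D.oldPlace a p) = u p := by
  rcases p with p | m <;> rfl

theorem Diagram.extendMark_newMark {α : Type} (D : Diagram I) (a : I ⊕ D.Place)
    (u : D.Place → α) (v : α) : D.extendMark a u v (D.newMark a) = v := rfl

/-- Old times become odd, `2 * t + 1`, which leaves room for the mark at the even time right after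
the place before it, or at `0` if its arc starts at an input. The arc that starts at `a` is reached
from the place `D.turn S a`, since `turn` is an involution. -/
theorem IsFlow.addMark {D : Diagram I} {S : Finset D.X} {σ : Equiv.Perm I} {b : D.Place → I}
    {t : D.Place → ℕ} (h : IsFlow (D.pass S) σ b t) (a : I ⊕ D.Place) :
    IsFlow ((D.addMark a).pass S) σ
      (D.extendMark a b (Sum.elim id (b ∘ D.turn S) a))
      (D.extendMark a (fun p => 2 * t p + 1)
        (Sum.elim (fun _ => 0) (fun p => 2 * t (D.turn S p) + 2) a)) := by
  have hcases (x : I ⊕ (D.addMark a).Place) :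
      x = Sum.inr (D.newMark a) ∨ ∃ y, x = Sum.map id (D.oldPlace a) y := by
    rcases x with i | p | m | u
    exacts [.inr ⟨Sum.inl i, rfl⟩, .inr ⟨Sum.inr (Sum.inl p), rfl⟩,
      .inr ⟨Sum.inr (Sum.inr m), rfl⟩, .inl rfl]
  intro x
  rcases hcases x with rfl | ⟨y, rfl⟩
  · rw [D.addMark_pass_newMark]
    have h1 := h (Sum.map id (D.turn S) a)
    have h2 : D.pass S (Sum.map id (D.turn S) a) = D.next a := by
      rw [D.pass_eq_next]
      cases a <;> simp [D.turn_turn]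
    rw [h2] at h1
    generalize D.next a = z at h1
    cases a <;> cases z <;>
      simp_all [Linked, Diagram.extendMark_oldPlace, Diagram.extendMark_newMark]
    omega
  · rw [D.addMark_pass_oldPlace]
    by_cases hx : Sum.map id (D.turn S) y = a
    · rw [hx, D.addMark_next_self]
      subst hx
      cases y <;>
        simp [Linked, Diagram.extendMark_oldPlace, Diagram.extendMark_newMark, D.turn_turn]
    · rw [D.addMark_next_of_ne hx]
      have h1 := h y
      rw [D.pass_eq_next] at h1
      generalize D.next _ = z at h1
      cases y <;> cases z <;> simp_all [Linked, Diagram.extendMark_oldPlace]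

theorem Diagram.addMark_conway [LinearOrder I] (D : Diagram I) (a : I ⊕ D.Place) :
    (D.addMark a).conway = D.conway := by
  symm
  refine Diagram.conway_congr (D' := D.addMark a) (Equiv.refl D.X) (fun _ => rfl) fun S => ?_
  -- `D.addMark a` has the crossings of `D` by definition, so the image of `S` may be read as a set
  -- of crossings of `D` and simplified there.
  have hS : S.map (Equiv.refl D.X).toEmbedding = S := Finset.map_refl
  change _ ↔ (D.addMark a).DescendsVia 1 (· < ·)
    (show Finset D.X from S.map (Equiv.refl D.X).toEmbedding)
  rw [hS]
  constructor
  · intro h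
    obtain ⟨b, t, hf⟩ := h.exists_isFlow
    rw [(hf.addMark a).descendsVia_iff]
    rw [hf.descendsVia_iff] at h
    intro c hc
    obtain ⟨h1, h2⟩ := h c hc
    exact ⟨h1, h2.imp_right fun ⟨h3, h4⟩ => ⟨h3, by
      change 2 * t (Sum.inl (c, (D.kind c).over)) + 1 <
        2 * t (Sum.inl (c, !(D.kind c).over)) + 1
      omega⟩⟩
  · intro h
    obtain ⟨b, t, hf⟩ := h.exists_isFlow
    rw [hf.of_addMark.descendsVia_iff]
    rw [hf.descendsVia_iff] at h
    exact fun c hc => h c hc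

end Isotopy

/-! ### States of a diagram with a small disk -/

section Fill

variable {I K : Type}

/-- Strings without crossings, which lead from `k` to `σ k`. -/
def permDiagram (σ : Equiv.Perm K) : Diagram K where
  X := Empty
  M := Empty
  kind := Empty.elim
  next := Equiv.sumCongr σ (Equiv.refl _)

/-- The places in the outer part of a diagram. -/
abbrev Context.Place (C : Context I K) : Type := C.X × Side ⊕ C.M

open Classical in
/-- How one passes through a vertex of the outer part, see `Diagram.turn`. -/
noncomputable def Context.turn (C : Context I K) (S : Finset C.X) :
    C.Place → C.Place
  | Sum.inl (c, s) => Sum.inl (c, if c ∈ S then s else !s)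
  | Sum.inr m => Sum.inr m

theorem Context.turn_of_mem (C : Context I K) {S : Finset C.X} {c : C.X} (h : c ∈ S) (s : Side) :
    C.turn S (Sum.inl (c, s)) = Sum.inl (c, s) := by
  simp [Context.turn, h]

theorem Context.turn_of_notMem (C : Context I K) {S : Finset C.X} {c : C.X} (h : c ∉ S)
    (s : Side) : C.turn S (Sum.inl (c, s)) = Sum.inl (c, !s) := by
  simp [Context.turn, h]

variable [Fintype K] (C : Context I K) (T : Diagram K)

/-- The places in the outer part. -/
def Context.outerPlace : C.Place → (C.fill T).Place :=
  Sum.map (Prod.map Sum.inl id) (fun m => Sum.inl (Sum.inl m))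

/-- The places in the small disk. -/
def Context.innerPlace : T.Place → (C.fill T).Place :=
  Sum.map (Prod.map Sum.inr id) (fun m => Sum.inl (Sum.inr m))

/-- The places where one enters the small disk. -/
def Context.entry (k : K) : (C.fill T).Place :=
  Sum.inr (Sum.inr (Sum.inl k))

/-- The places where one leaves the small disk. -/
def Context.exit (k : K) : (C.fill T).Place :=
  Sum.inr (Sum.inr (Sum.inr k))

/-- The places that one may reach on leaving the outer part, or on staying there. -/
def Context.outerTarget : (I ⊕ C.Place) ⊕ K → I ⊕ (C.fill T).Place
  | Sum.inl x => Sum.map id (C.outerPlace T) x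
  | Sum.inr k => Sum.inr (C.entry T k)

/-- The places from which one goes along the outer part. -/
def Context.outerSource : (I ⊕ C.Place) ⊕ K → I ⊕ (C.fill T).Place
  | Sum.inl x => Sum.map id (C.outerPlace T) x
  | Sum.inr k => Sum.inr (C.exit T k)

/-- The places that one may reach on leaving the small disk, or on staying there. -/
def Context.innerTarget : K ⊕ T.Place → (C.fill T).Place
  | Sum.inl k => C.exit T k
  | Sum.inr q => C.innerPlace T q

/-- The places from which one goes along the small disk. -/
def Context.innerSource : K ⊕ T.Place → (C.fill T).Place
  | Sum.inl k => C.entry T k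
  | Sum.inr q => C.innerPlace T q

theorem Context.exists_source (x : I ⊕ (C.fill T).Place) :
    (∃ y, x = C.outerSource T y) ∨ ∃ y, x = Sum.inr (C.innerSource T y) := by
  rcases x with i | ⟨c | c, s⟩ | (m | m) | k | k
  · exact .inl ⟨Sum.inl (Sum.inl i), rfl⟩
  · exact .inl ⟨Sum.inl (Sum.inr (Sum.inl (c, s))), rfl⟩
  · exact .inr ⟨Sum.inr (Sum.inl (c, s)), rfl⟩
  · exact .inl ⟨Sum.inl (Sum.inr (Sum.inr m)), rfl⟩
  · exact .inr ⟨Sum.inr (Sum.inr m), rfl⟩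
  · exact .inr ⟨Sum.inl k, rfl⟩
  · exact .inl ⟨Sum.inr k, rfl⟩

/-- Functions on the places of `C.fill T`. -/
def Context.placeElim {α : Type} (u : C.Place → α) (v : T.Place → α) (w w' : K → α) :
    (C.fill T).Place → α
  | Sum.inl (Sum.inl c, s) => u (Sum.inl (c, s))
  | Sum.inl (Sum.inr c, s) => v (Sum.inl (c, s))
  | Sum.inr (Sum.inl (Sum.inl m)) => u (Sum.inr m)
  | Sum.inr (Sum.inl (Sum.inr m)) => v (Sum.inr m)
  | Sum.inr (Sum.inr (Sum.inl k)) => w k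
  | Sum.inr (Sum.inr (Sum.inr k)) => w' k

section

variable {α : Type} (u : C.Place → α) (v : T.Place → α) (w w' : K → α)

theorem Context.placeElim_outerPlace (p : C.Place) :
    C.placeElim T u v w w' (C.outerPlace T p) = u p := by
  rcases p with p | m <;> rfl

theorem Context.placeElim_innerPlace (p : T.Place) :
    C.placeElim T u v w w' (C.innerPlace T p) = v p := by
  rcases p with p | m <;> rfl

theorem Context.placeElim_entry (k : K) : C.placeElim T u v w w' (C.entry T k) = w k := rfl

theorem Context.placeElim_exit (k : K) : C.placeElim T u v w w' (C.exit T k) = w' k := rfl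

end

theorem Context.fill_next_outer (y : (I ⊕ C.Place) ⊕ K) :
    (C.fill T).next (C.outerSource T y) = C.outerTarget T (C.next y) := by
  have h1 : splitEnds I C.X T.X C.M T.M K K (C.outerSource T y) = Sum.inl y := by
    rcases y with (i | p | m) | k <;> rfl
  change Equiv.sumCongr (Equiv.refl I) (Equiv.sumCongr (Equiv.refl _)
      (Equiv.sumCongr (Equiv.refl _) (Equiv.sumComm K K)))
    ((splitEnds I C.X T.X C.M T.M K K).symm (Equiv.sumCongr C.next T.next
      (splitEnds I C.X T.X C.M T.M K K (C.outerSource T y)))) = _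
  rw [h1]
  change Equiv.sumCongr (Equiv.refl I) (Equiv.sumCongr (Equiv.refl _)
      (Equiv.sumCongr (Equiv.refl _) (Equiv.sumComm K K)))
    ((splitEnds I C.X T.X C.M T.M K K).symm (Sum.inl (C.next y))) = _
  generalize C.next y = z
  rcases z with (i | p | m) | k <;> rfl

theorem Context.fill_next_inner (y : K ⊕ T.Place) :
    (C.fill T).next (Sum.inr (C.innerSource T y)) = Sum.inr (C.innerTarget T (T.next y)) := by
  have h1 : splitEnds I C.X T.X C.M T.M K K (Sum.inr (C.innerSource T y)) = Sum.inr y := by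
    rcases y with k | p | m <;> rfl
  change Equiv.sumCongr (Equiv.refl I) (Equiv.sumCongr (Equiv.refl _)
      (Equiv.sumCongr (Equiv.refl _) (Equiv.sumComm K K)))
    ((splitEnds I C.X T.X C.M T.M K K).symm (Equiv.sumCongr C.next T.next
      (splitEnds I C.X T.X C.M T.M K K (Sum.inr (C.innerSource T y))))) = _
  rw [h1]
  change Equiv.sumCongr (Equiv.refl I) (Equiv.sumCongr (Equiv.refl _)
      (Equiv.sumCongr (Equiv.refl _) (Equiv.sumComm K K)))
    ((splitEnds I C.X T.X C.M T.M K K).symm (Sum.inr (T.next y))) = _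
  generalize T.next y = z
  rcases z with k | p | m <;> rfl

/-! ### Composition and decomposition of flows -/

variable (S : Finset C.X) (S' : Finset T.X)

/-- A set of crossings of `C.fill T`. -/
def Context.fillState : Finset (C.fill T).X := S.disjSum S'

theorem Context.turn_outerPlace (p : C.Place) :
    (C.fill T).turn (C.fillState T S S') (C.outerPlace T p) = C.outerPlace T (C.turn S p) := by
  rcases p with ⟨c, s⟩ | m
  · have h : (Sum.inl c : (C.fill T).X) ∈ C.fillState T S S' ↔ c ∈ S := Finset.inl_mem_disjSum
    by_cases hc : c ∈ S
    · exact ((C.fill T).turn_of_mem (h.2 hc) s).trans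
        (congrArg (C.outerPlace T) (C.turn_of_mem hc s)).symm
    · exact ((C.fill T).turn_of_notMem (fun h' => hc (h.1 h')) s).trans
        (congrArg (C.outerPlace T) (C.turn_of_notMem hc s)).symm
  · rfl

theorem Context.turn_innerPlace (p : T.Place) :
    (C.fill T).turn (C.fillState T S S') (C.innerPlace T p) = C.innerPlace T (T.turn S' p) := by
  rcases p with ⟨c, s⟩ | m
  · have h : (Sum.inr c : (C.fill T).X) ∈ C.fillState T S S' ↔ c ∈ S' :=
      Finset.inr_mem_disjSum
    by_cases hc : c ∈ S'
    · exact ((C.fill T).turn_of_mem (h.2 hc) s).trans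
        (congrArg (C.innerPlace T) (T.turn_of_mem hc s)).symm
    · exact ((C.fill T).turn_of_notMem (fun h' => hc (h.1 h')) s).trans
        (congrArg (C.innerPlace T) (T.turn_of_notMem hc s)).symm
  · rfl

/-- The strings in the outer part, see `Diagram.pass`. -/
noncomputable def Context.pass (y : (I ⊕ C.Place) ⊕ K) : (I ⊕ C.Place) ⊕ K :=
  C.next (Sum.map (Sum.map id (C.turn S)) id y)

theorem Context.fill_pass_outer (y : (I ⊕ C.Place) ⊕ K) :
    (C.fill T).pass (C.fillState T S S') (C.outerSource T y) =
      C.outerTarget T (C.pass S y) := by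
  rw [Diagram.pass_eq_next, Context.pass, ← C.fill_next_outer]
  rcases y with (i | p) | k
  · rfl
  · simp only [Context.outerSource, Sum.map_inr, Sum.map_inl, C.turn_outerPlace]
  · rfl

theorem Context.fill_pass_inner (y : K ⊕ T.Place) :
    (C.fill T).pass (C.fillState T S S') (Sum.inr (C.innerSource T y)) =
      Sum.inr (C.innerTarget T (T.pass S' y)) := by
  rw [Diagram.pass_eq_next, Diagram.pass_eq_next, ← C.fill_next_inner]
  rcases y with k | p
  · rfl
  · simp only [Context.innerSource, Sum.map_inr, C.turn_innerPlace]

/-- The state that one gets on the replacement of the small disk by strings without crossings. -/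
abbrev Context.outerState (σ : Equiv.Perm K) : Finset (C.fill (permDiagram σ)).X :=
  C.fillState (permDiagram σ) S ∅

theorem Context.outerState_pass_entry (σ : Equiv.Perm K) (k : K) :
    (C.fill (permDiagram σ)).pass (C.outerState S σ) (Sum.inr (C.entry (permDiagram σ) k)) =
      Sum.inr (C.exit (permDiagram σ) (σ k)) :=
  C.fill_pass_inner (permDiagram σ) S ∅ (Sum.inl k)

variable {C T S S'}

/-- Composition of a flow in the outer part and a flow in the small disk. -/
theorem IsFlow.fill {σ : Equiv.Perm K} {b : T.Place → K} {s : T.Place → ℕ}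
    (hs : IsFlow (T.pass S') σ b s) {τ : Equiv.Perm I}
    {a : (C.fill (permDiagram σ)).Place → I} {t : (C.fill (permDiagram σ)).Place → ℕ}
    (ht : IsFlow ((C.fill (permDiagram σ)).pass (C.outerState S σ)) τ a t) :
    IsFlow ((C.fill T).pass (C.fillState T S S')) τ
      (C.placeElim T (fun p => a (C.outerPlace _ p)) (fun q => a (C.entry _ (b q)))
        (fun k => a (C.entry _ k)) (fun k => a (C.exit _ k)))
      (C.placeElim T (fun p => toLex (t (C.outerPlace _ p), 0))
        (fun q => toLex (t (C.entry _ (b q)), s q + 1))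
        (fun k => toLex (t (C.entry _ k), 0)) (fun k => toLex (t (C.exit _ k), 0))) := by
  -- Times are lexicographic: a place inside gets the outer time of its entry, refined by the inner
  -- time. The `+ 1` puts it after the entry, which has second component `0`; this inequality puts
  -- it before the exit.
  have hk (k : K) : a (C.exit _ (σ k)) = a (C.entry _ k) ∧
      t (C.entry _ k) < t (C.exit _ (σ k)) := by
    have := ht (Sum.inr (C.entry _ k))
    rw [C.outerState_pass_entry] at this
    exact this
  intro x
  rcases C.exists_source T x with ⟨y, rfl⟩ | ⟨y, rfl⟩
  · have h := ht (C.outerSource _ y)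
    rw [C.fill_pass_outer] at h ⊢
    generalize C.pass S y = z at h
    rcases y with (i | p) | k <;> rcases z with (j | q) | l <;>
      simpa [Context.outerSource, Context.outerTarget, Linked, C.placeElim_outerPlace,
        C.placeElim_entry, C.placeElim_exit, Prod.Lex.toLex_lt_toLex] using h
  · rw [C.fill_pass_inner]
    have h := hs y
    generalize T.pass S' y = z at h
    rcases y with k | p <;> rcases z with l | q <;>
      simp only [Context.innerSource, Context.innerTarget, Linked, C.placeElim_innerPlace,
        C.placeElim_entry, C.placeElim_exit, Prod.Lex.toLex_lt_toLex] at h ⊢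
    · rw [← h]
      exact ⟨(hk k).1, .inl (hk k).2⟩
    · rw [h]
      exact ⟨rfl, .inr ⟨rfl, Nat.succ_pos _⟩⟩
    · rw [← h]
      exact ⟨(hk _).1, .inl (hk _).2⟩
    · rw [h.1]
      exact ⟨rfl, .inr ⟨rfl, Nat.succ_lt_succ h.2⟩⟩

/-- Decomposition of a flow. -/
theorem IsFlow.exists_of_fill {τ : Equiv.Perm I} {a : (C.fill T).Place → I}
    {t : (C.fill T).Place → ℕ} (h : IsFlow ((C.fill T).pass (C.fillState T S S')) τ a t) :
    ∃ (σ : Equiv.Perm K) (b : T.Place → K) (s : T.Place → ℕ)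
      (a' : (C.fill (permDiagram σ)).Place → I) (t' : (C.fill (permDiagram σ)).Place → ℕ),
      IsFlow (T.pass S') σ b s ∧
        IsFlow ((C.fill (permDiagram σ)).pass (C.outerState S σ)) τ a' t' := by
  have hin (y : K ⊕ T.Place) : a (C.innerTarget T (T.pass S' y)) = a (C.innerSource T y) ∧
      t (C.innerSource T y) < t (C.innerTarget T (T.pass S' y)) := by
    have := h (Sum.inr (C.innerSource T y))
    rw [C.fill_pass_inner] at this
    exact this
  -- The global time increases along the arcs inside, so there are no circles in the disk, and the
  -- inner strings have a flow of their own.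
  obtain ⟨σ, b, s, hs⟩ := OrderedTangle.exists_isFlow (T.pass S')
    (fun q => t (C.innerPlace T q)) fun p q hpq => by
      have := (hin (Sum.inr p)).2
      rwa [hpq] at this
  -- An inner place lies on the global string of its entry, and later than the entry; the same then
  -- holds for the exit, which is what the replacement by `permDiagram σ` requires.
  have hb (q : T.Place) : a (C.innerPlace T q) = a (C.entry T (b q)) ∧
      t (C.entry T (b q)) < t (C.innerPlace T q) := by
    refine hs.induction (Q := fun k q => a (C.innerPlace T q) = a (C.entry T k) ∧
      t (C.entry T k) < t (C.innerPlace T q)) (fun k q hq => ?_) (fun p q hq hp => ?_) q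
    · have := hin (Sum.inl k)
      rwa [hq] at this
    · have := hin (Sum.inr p)
      rw [hq] at this
      exact ⟨this.1.trans hp.1, hp.2.trans this.2⟩
  have hk (k : K) : a (C.exit T (σ k)) = a (C.entry T k) ∧
      t (C.entry T k) < t (C.exit T (σ k)) := by
    obtain ⟨x, hx⟩ := (T.pass S').surjective (Sum.inl (σ k))
    have h1 := hs x
    have h2 := hin x
    rw [hx] at h1 h2
    cases x with
    | inl l =>
      obtain rfl := σ.injective (show σ l = σ k from h1)
      exact h2
    | inr q =>
      obtain rfl := σ.injective (show σ (b q) = σ k from h1)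
      exact ⟨h2.1.trans (hb q).1, (hb q).2.trans h2.2⟩
  -- `permDiagram σ` has no inner places, so the second argument of `placeElim` is a function on an
  -- empty type.
  refine ⟨σ, b, s, C.placeElim _ (fun p => a (C.outerPlace T p))
    (Sum.elim (fun x => x.1.elim) Empty.elim)
    (fun k => a (C.entry T k)) (fun k => a (C.exit T k)),
    C.placeElim _ (fun p => t (C.outerPlace T p)) (Sum.elim (fun x => x.1.elim) Empty.elim)
    (fun k => t (C.entry T k)) (fun k => t (C.exit T k)), hs, fun x => ?_⟩
  rcases C.exists_source _ x with ⟨y, rfl⟩ | ⟨k | ⟨⟨⟨⟩, -⟩ | ⟨⟨⟩⟩⟩, rfl⟩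
  · have h := h (C.outerSource _ y)
    rw [C.fill_pass_outer] at h ⊢
    generalize C.pass S y = z at h
    rcases y with (i | p) | k <;> rcases z with (j | q) | l <;>
      simpa [Context.outerSource, Context.outerTarget, Linked, C.placeElim_outerPlace,
        C.placeElim_entry, C.placeElim_exit] using h
  · have := C.outerState_pass_entry S σ k
    change Linked _ _ _ _ ((C.fill (permDiagram σ)).pass (C.outerState S σ)
      (Sum.inr (C.entry (permDiagram σ) k)))
    rw [this]
    exact hk k

/-- The order in which one enters the small disk along its strings. -/
def Context.EntersBefore [LT I] (C : Context I K) (S : Finset C.X) (σ : Equiv.Perm K)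
    (k k' : K) : Prop :=
  RouteBefore ((C.fill (permDiagram σ)).pass (C.outerState S σ)) (· < ·)
    (C.entry (permDiagram σ) k) (C.entry (permDiagram σ) k')

/-- The crossings of the two parts are compared separately. Outside, the second time component is
always `0` and drops out. Inside, the lexicographic order means: first by entry, then by inner time.
-/
theorem IsFlow.descendsVia_fill_iff [LinearOrder I] {σ : Equiv.Perm K} {b : T.Place → K}
    {s : T.Place → ℕ} (hs : IsFlow (T.pass S') σ b s) {τ : Equiv.Perm I}
    {a : (C.fill (permDiagram σ)).Place → I} {t : (C.fill (permDiagram σ)).Place → ℕ}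
    (ht : IsFlow ((C.fill (permDiagram σ)).pass (C.outerState S σ)) τ a t) :
    (C.fill T).DescendsVia τ (· < ·) (C.fillState T S S') ↔
      T.DescendsVia σ (C.EntersBefore S σ) S' ∧
        (C.fill (permDiagram σ)).DescendsVia τ (· < ·) (C.outerState S σ) := by
  rw [(hs.fill ht).descendsVia_iff, hs.descendsVia_iff, ht.descendsVia_iff]
  have houter : ∀ c, ((C.kind c ≠ Kind.virt ∧
      (a (Sum.inl (Sum.inl c, (C.kind c).over)) < a (Sum.inl (Sum.inl c, !(C.kind c).over)) ∨
      a (Sum.inl (Sum.inl c, (C.kind c).over)) = a (Sum.inl (Sum.inl c, !(C.kind c).over)) ∧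
      t (Sum.inl (Sum.inl c, (C.kind c).over)) < t (Sum.inl (Sum.inl c, !(C.kind c).over))))) ↔
      ((C.kind c ≠ Kind.virt ∧
      (a (Sum.inl (Sum.inl c, (C.kind c).over)) < a (Sum.inl (Sum.inl c, !(C.kind c).over)) ∨
      a (Sum.inl (Sum.inl c, (C.kind c).over)) = a (Sum.inl (Sum.inl c, !(C.kind c).over)) ∧
      toLex (t (Sum.inl (Sum.inl c, (C.kind c).over)), 0) <
        toLex (t (Sum.inl (Sum.inl c, !(C.kind c).over)), 0)))) := by
    intro c
    simp [Prod.Lex.toLex_lt_toLex]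
  have hinner (q q' : T.Place) : C.EntersBefore S σ (b q) (b q') ∨ b q = b q' ∧ s q < s q' ↔
      a (C.entry _ (b q)) < a (C.entry _ (b q')) ∨
        a (C.entry _ (b q)) = a (C.entry _ (b q')) ∧
        toLex (t (C.entry _ (b q)), s q + 1) < toLex (t (C.entry _ (b q')), s q' + 1) := by
    rw [Context.EntersBefore, ht.routeBefore_iff, Prod.Lex.toLex_lt_toLex]
    constructor
    · rintro ((h | ⟨h1, h2⟩) | ⟨h1, h2⟩)
      · exact .inl h
      · exact .inr ⟨h1, .inl h2⟩
      · rw [h1]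
        exact .inr ⟨rfl, .inr ⟨rfl, Nat.succ_lt_succ h2⟩⟩
    · rintro (h | ⟨h1, h2 | ⟨h2, h3⟩⟩)
      · exact .inl (.inl h)
      · exact .inl (.inr ⟨h1, h2⟩)
      -- Entries with the same string and time coincide, so both places are on one inner string and
      -- the inner times decide.
      · have := ht.place_ext h1 h2
        refine .inr ⟨?_, Nat.lt_of_succ_lt_succ h3⟩
        exact Sum.inl_injective (Sum.inr_injective (Sum.inr_injective this))
  constructor
  · intro h
    constructor
    · intro c hc
      obtain ⟨h1, h2⟩ := h (Sum.inr c) (Finset.inr_mem_disjSum.2 hc)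
      exact ⟨h1, (hinner (Sum.inl (c, (T.kind c).over)) (Sum.inl (c, !(T.kind c).over))).2 h2⟩
    · rintro (c | ⟨⟨⟩⟩) hc
      exact (houter c).2 (h (Sum.inl c) (Finset.inl_mem_disjSum.2 (Finset.inl_mem_disjSum.1 hc)))
  · rintro ⟨h1, h2⟩ (c | c) hc
    · exact (houter c).1
        (h2 (Sum.inl c) (Finset.inl_mem_disjSum.2 (Finset.inl_mem_disjSum.1 hc)))
    · obtain ⟨h3, h4⟩ := h1 c (Finset.inr_mem_disjSum.1 hc)
      exact ⟨h3, (hinner (Sum.inl (c, (T.kind c).over)) (Sum.inl (c, !(T.kind c).over))).1 h4⟩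

theorem Context.descendsVia_fill_iff [LinearOrder I] {τ : Equiv.Perm I} :
    (C.fill T).DescendsVia τ (· < ·) (C.fillState T S S') ↔
      ∃ σ : Equiv.Perm K, (C.fill (permDiagram σ)).DescendsVia τ (· < ·) (C.outerState S σ) ∧
        T.DescendsVia σ (C.EntersBefore S σ) S' := by
  constructor
  · intro h
    obtain ⟨a, t, hf⟩ := h.exists_isFlow
    obtain ⟨σ, b, s, a', t', h1, h2⟩ := hf.exists_of_fill
    exact ⟨σ, ((h1.descendsVia_fill_iff h2).1 h).symm⟩
  · rintro ⟨σ, h1, h2⟩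
    obtain ⟨a, t, ht⟩ := h1.exists_isFlow
    obtain ⟨b, s, hs⟩ := h2.exists_isFlow
    exact (hs.descendsVia_fill_iff ht).2 ⟨h2, h1⟩

/-- The order in which one enters the small disk is a strict total order; it is described by an
injective function. -/
theorem Context.exists_rank [LinearOrder I] {τ : Equiv.Perm I} {σ : Equiv.Perm K}
    (h : (C.fill (permDiagram σ)).DescendsVia τ (· < ·) (C.outerState S σ)) :
    ∃ ρ : K → ℕ, (∀ k, ρ k < Fintype.card K) ∧ Function.Injective ρ ∧
      ∀ k k', C.EntersBefore S σ k k' ↔ ρ k < ρ k' := by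
  classical
  obtain ⟨a, t, ht⟩ := h.exists_isFlow
  let g (k : K) : I ×ₗ ℕ := toLex (a (C.entry _ k), t (C.entry _ k))
  have hg : Function.Injective g := fun k k' hk => by
    have hk' := Prod.mk.inj (toLex.injective hk)
    exact Sum.inl_injective (Sum.inr_injective (Sum.inr_injective (ht.place_ext hk'.1 hk'.2)))
  have hlt (k k' : K) : C.EntersBefore S σ k k' ↔ g k < g k' := by
    rw [Context.EntersBefore, ht.routeBefore_iff, Prod.Lex.toLex_lt_toLex]
  -- The rank of an entry is the number of entries before it.
  let ρ (k : K) : ℕ := (Finset.univ.filter fun l => g l < g k).card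
  have hρ {k k' : K} (hk : g k < g k') : ρ k < ρ k' := by
    refine Finset.card_lt_card (Finset.ssubset_iff_of_subset ?_ |>.2 ⟨k, by simpa, by simp⟩)
    intro l hl
    simp only [Finset.mem_filter, Finset.mem_univ, true_and] at hl ⊢
    exact hl.trans hk
  refine ⟨ρ, fun k => ?_, fun k k' hk => ?_, fun k k' => ?_⟩
  · exact Finset.card_lt_card (Finset.ssubset_univ_iff.2 fun hu =>
      absurd (Finset.mem_univ k) (by rw [← hu]; simp))
  · by_contra hne
    rcases lt_or_gt_of_ne (hg.ne hne) with h' | h'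
    · exact (hρ h').ne hk
    · exact (hρ h').ne' hk
  · rw [hlt]
    refine ⟨hρ, fun hk => ?_⟩
    by_contra hn
    rcases (not_lt.1 hn).eq_or_lt with h' | h'
    · rw [hg h'] at hk
      exact lt_irrefl _ hk
    · exact (hρ h').asymm hk

/-! ### Factorization of the state sum -/

theorem Finset.sum_univ_disjSum {α β M : Type} [Fintype α] [Fintype β] [AddCommMonoid M]
    (F : Finset (α ⊕ β) → M) :
    ∑ S, F S = ∑ S : Finset α, ∑ S' : Finset β, F (S.disjSum S') := by
  classical
  rw [← Fintype.sum_prod_type']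
  refine Fintype.sum_equiv Finset.sumEquiv.toEquiv _ _ fun S => congrArg F ?_
  exact (Finset.sumEquiv.symm_apply_apply S).symm

-- The outer condition involves only `S` and `σ`, so the sum over inner states can be pulled out as
-- `T.stateSum`. Summation over `σ` does not count a state twice, because the inner state determines
-- `σ`.
open Classical in
theorem Context.conway_fill [LinearOrder I] (C : Context I K) (T : Diagram K) :
    (C.fill T).conway = ∑ S : Finset C.X, ∑ σ : Equiv.Perm K,
      if (C.fill (permDiagram σ)).DescendsVia 1 (· < ·) (C.outerState S σ) then
        (∏ c ∈ S, (Polynomial.C (C.kind c).sign * Polynomial.X)) *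
          T.stateSum σ (C.EntersBefore S σ) else 0 := by
  rw [Diagram.conway_eq_stateSum, Diagram.stateSum]
  refine (Finset.sum_univ_disjSum (α := C.X) (β := T.X) _).trans
    (Finset.sum_congr rfl fun S _ => ?_)
  have hprod (S' : Finset T.X) :
      (∏ c ∈ C.fillState T S S', (Polynomial.C ((C.fill T).kind c).sign * Polynomial.X)) =
        (∏ c ∈ S, (Polynomial.C (C.kind c).sign * Polynomial.X)) *
          ∏ c ∈ S', (Polynomial.C (T.kind c).sign * Polynomial.X) :=
    Finset.prod_disjSum S S' _
  have hmul (σ : Equiv.Perm K) :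
      (if (C.fill (permDiagram σ)).DescendsVia 1 (· < ·) (C.outerState S σ) then
        (∏ c ∈ S, (Polynomial.C (C.kind c).sign * Polynomial.X)) *
          T.stateSum σ (C.EntersBefore S σ) else 0) =
      ∑ S' : Finset T.X,
        if (C.fill (permDiagram σ)).DescendsVia 1 (· < ·) (C.outerState S σ) ∧
            T.DescendsVia σ (C.EntersBefore S σ) S' then
          ∏ c ∈ C.fillState T S S', (Polynomial.C ((C.fill T).kind c).sign * Polynomial.X)
        else 0 := by
    by_cases h : (C.fill (permDiagram σ)).DescendsVia 1 (· < ·) (C.outerState S σ)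
    · simp only [h, if_true, true_and, Diagram.stateSum, Finset.mul_sum, mul_ite, mul_zero, hprod]
    · simp only [h, if_false, false_and, Finset.sum_const_zero]
  rw [Finset.sum_congr rfl fun σ _ => hmul σ, Finset.sum_comm]
  refine Finset.sum_congr rfl fun S' _ => ?_
  change (if (C.fill T).DescendsVia 1 (· < ·) (C.fillState T S S') then
    ∏ c ∈ C.fillState T S S', (Polynomial.C ((C.fill T).kind c).sign * Polynomial.X) else 0) = _
  by_cases h : (C.fill T).DescendsVia 1 (· < ·) (C.fillState T S S')
  · rw [if_pos h]
    obtain ⟨σ, hσ⟩ := C.descendsVia_fill_iff.1 h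
    rw [Finset.sum_eq_single σ, if_pos hσ]
    · exact fun σ' _ hne => if_neg fun h' => hne (h'.2.perm_unique hσ.2)
    · exact fun h' => absurd (Finset.mem_univ σ) h'
  · rw [if_neg h]
    exact (Finset.sum_eq_zero fun σ _ =>
      if_neg fun h' => h (C.descendsVia_fill_iff.2 ⟨σ, h'⟩)).symm

/-- The contribution of a small disk depends only on the sums over its descending states. -/
theorem Context.conway_fill_congr [LinearOrder I] (C : Context I K) {T T' : Diagram K}
    (h : ∀ (σ : Equiv.Perm K) (ρ : K → ℕ), (∀ k, ρ k < Fintype.card K) →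
      Function.Injective ρ → T.stateSum σ (fun k k' => ρ k < ρ k') =
        T'.stateSum σ fun k k' => ρ k < ρ k') : (C.fill T).conway = (C.fill T').conway := by
  classical
  rw [C.conway_fill, C.conway_fill]
  refine Finset.sum_congr rfl fun S _ => Finset.sum_congr rfl fun σ _ => ?_
  split_ifs with hσ
  · obtain ⟨ρ, h1, h2, h3⟩ := Context.exists_rank hσ
    have hR : C.EntersBefore S σ = fun k k' => ρ k < ρ k' :=
      funext₂ fun k k' => propext (h3 k k')
    rw [hR, h σ ρ h1 h2]
  · rfl

end Fill

/-! ### Computation of the states of a small diagram -/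

section Trace

variable {K X M : Type}

/-- How one passes through a vertex, if `s` tells which crossings are smoothed. -/
def turnAt (s : X → Bool) : X × Side ⊕ M → X × Side ⊕ M
  | Sum.inl (c, b) => Sum.inl (c, bif s c then b else !b)
  | Sum.inr m => Sum.inr m

/-- Follow a string backwards to its input, and count the steps; `prev` leads backwards along the
arcs, and the number of steps is bounded. -/
def trace (prev : K ⊕ (X × Side ⊕ M) → K ⊕ (X × Side ⊕ M)) (s : X → Bool) :
    ℕ → K ⊕ (X × Side ⊕ M) → Option (K × ℕ)
  | 0, _ => none
  | n + 1, x =>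
    match prev x with
    | Sum.inl k => some (k, 0)
    | Sum.inr q => (trace prev s n (Sum.inr (turnAt s q))).map fun u => (u.1, u.2 + 1)

/-- Comparison of two places that are found by `trace`. -/
def traceBefore (ρ : K → ℕ) : Option (K × ℕ) → Option (K × ℕ) → Bool
  | some u, some v => Nat.blt (ρ u.1) (ρ v.1) || (Nat.beq (ρ u.1) (ρ v.1) && Nat.blt u.2 v.2)
  | _, _ => false

/-- Decide whether a crossing is real. -/
def Kind.isReal : Kind → Bool
  | .virt => false
  | _ => true

theorem Kind.isReal_iff (κ : Kind) : κ.isReal = true ↔ κ ≠ Kind.virt := by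
  cases κ <;> simp [Kind.isReal]

variable (prev : K ⊕ (X × Side ⊕ M) → K ⊕ (X × Side ⊕ M)) (kind : X → Kind) (xs : List X)

/-- Check that there are no closed components, and that the crossings that are smoothed are real
and are passed first on the overpass. -/
def checkState (ρ : K → ℕ) (s : X → Bool) : Bool :=
  (xs.all fun c => (trace prev s (2 * xs.length) (Sum.inr (Sum.inl (c, false)))).isSome &&
    (trace prev s (2 * xs.length) (Sum.inr (Sum.inl (c, true)))).isSome) &&
  xs.all fun c => !s c || ((kind c).isReal && traceBefore ρ
    (trace prev s (2 * xs.length) (Sum.inr (Sum.inl (c, (kind c).over))))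
    (trace prev s (2 * xs.length) (Sum.inr (Sum.inl (c, !(kind c).over)))))

/-- The input of the string that leads to the output `j`. -/
def origin (s : X → Bool) (j : K) : Option K :=
  (trace prev s (2 * xs.length + 1) (Sum.inl j)).map Prod.fst

/-- The origins of the outputs, the number of crossings and the sign of each descending state. -/
def entries (states : List (X → Bool)) (js : List K) (ρ : K → ℕ) :
    List ((ℕ × List (Option K)) × ℤ) :=
  (states.filter (checkState prev kind xs ρ)).map fun s =>
    (((xs.filter s).length, js.map (origin prev xs s)),
      ((xs.filter s).map fun c => (kind c).sign).prod)

end Trace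

section Local

variable {K : Type} (T : Diagram K)

/-- The set of the crossings that are smoothed. -/
def Diagram.smoothed (s : T.X → Bool) : Finset T.X :=
  Finset.univ.filter fun c => s c = true

theorem Diagram.mem_smoothed (s : T.X → Bool) (c : T.X) : c ∈ T.smoothed s ↔ s c = true := by
  simp [Diagram.smoothed]

theorem Diagram.turn_smoothed (s : T.X → Bool) (p : T.Place) :
    T.turn (T.smoothed s) p = turnAt s p := by
  rcases p with ⟨c, b⟩ | m
  · cases h : s c
    · rw [T.turn_of_notMem (by simp [T.mem_smoothed, h])]
      simp [turnAt, h]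
    · rw [T.turn_of_mem (by simp [T.mem_smoothed, h])]
      simp [turnAt, h]
  · rfl

variable {T} {s : T.X → Bool}

/-- Tracing back undoes the route step by step, because `turn` is its own inverse. -/
theorem Diagram.route_of_trace {n : ℕ} {x : K ⊕ T.Place} {u : K × ℕ}
    (h : trace T.next.symm s n x = some u) :
    route (T.pass (T.smoothed s)) u.1 u.2 = x := by
  induction n generalizing x u with
  | zero => simp [trace] at h
  | succ n ih =>
    rw [trace] at h
    cases hx : T.next.symm x with
    | inl k =>
      simp only [hx, Option.some.injEq] at h
      rw [← h, route_zero, Diagram.pass_inl, ← hx, Equiv.apply_symm_apply]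
    | inr q =>
      simp only [hx, Option.map_eq_some_iff] at h
      obtain ⟨v, hv, rfl⟩ := h
      rw [route_succ_of_eq_inr (ih hv), Diagram.pass_inr, ← T.turn_smoothed, T.turn_turn, ← hx,
        Equiv.apply_symm_apply]

theorem Diagram.trace_of_route {k : K} {m n : ℕ} {p : T.Place}
    (h : route (T.pass (T.smoothed s)) k m = Sum.inr p) (hmn : m < n) :
    trace T.next.symm s n (Sum.inr p) = some (k, m) := by
  induction m generalizing n p with
  | zero =>
    obtain ⟨n, rfl⟩ := Nat.exists_eq_succ_of_ne_zero hmn.ne'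
    rw [route_zero, Diagram.pass_inl] at h
    rw [trace, ← h, Equiv.symm_apply_apply]
  | succ m ih =>
    obtain ⟨n, rfl⟩ := Nat.exists_eq_succ_of_ne_zero (Nat.ne_of_gt (Nat.zero_lt_of_lt hmn))
    obtain ⟨q, hq, hp⟩ := exists_of_route_succ_eq_inr h
    rw [Diagram.pass_inr] at hp
    rw [trace, ← hp, Equiv.symm_apply_apply]
    simp only [← T.turn_smoothed, T.turn_turn]
    rw [ih hq (Nat.lt_of_succ_lt_succ hmn)]
    rfl

/-- The places passed up to time `m` are distinct. This bounds the number of steps that `trace`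
needs. -/
theorem lt_card_of_route {P : Type} [Fintype P] (f : Equiv.Perm (K ⊕ P)) {k : K} {m : ℕ} {p : P}
    (h : route f k m = Sum.inr p) : m < Fintype.card P := by
  have hex (j : Fin (m + 1)) : ∃ q, route f k j = Sum.inr q := by
    cases hj : route f k j with
    | inl i =>
      exact absurd (h.symm.trans (route_eq_inl_of_le hj (Nat.lt_succ_iff.1 j.2))) Sum.inr_ne_inl
    | inr q => exact ⟨q, rfl⟩
  choose g hg using hex
  have hinj : Function.Injective g := fun i j hij => by
    have h1 := hg i
    rw [hij] at h1
    exact Fin.ext (route_inr_unique f h1 (hg j)).2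
  have := Fintype.card_le_of_injective g hinj
  rw [Fintype.card_fin] at this
  exact this

variable [IsEmpty T.M] {xs : List T.X}

theorem Diagram.card_place_le (hxs : ∀ c, c ∈ xs) : Fintype.card T.Place ≤ 2 * xs.length := by
  classical
  rw [Fintype.card_sum, Fintype.card_eq_zero (α := T.M), Fintype.card_prod, Fintype.card_bool,
    add_zero, mul_comm]
  refine Nat.mul_le_mul_left 2 ?_
  rw [← Finset.card_univ, ← (Finset.eq_univ_iff_forall.2 fun c => List.mem_toFinset.2 (hxs c) :
    xs.toFinset = Finset.univ)]
  exact xs.toFinset_card_le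

theorem Diagram.descendsVia_iff_checkState (hxs : ∀ c, c ∈ xs) {ρ : K → ℕ}
    (hρ : Function.Injective ρ) (σ : Equiv.Perm K) :
    T.DescendsVia σ (fun k k' => ρ k < ρ k') (T.smoothed s) ↔
      checkState T.next.symm T.kind xs ρ s = true ∧
        ∀ j, origin T.next.symm xs s j = some (σ.symm j) := by
  have hbefore {u v : K × ℕ} : traceBefore ρ (some u) (some v) = true ↔
      ρ u.1 < ρ v.1 ∨ u.1 = v.1 ∧ u.2 < v.2 := by
    simp [traceBefore, hρ.eq_iff]
  constructor
  · rintro ⟨h1, ⟨h2, h3⟩, h4⟩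
    have htr (p : T.Place) : ∃ u, trace T.next.symm s (2 * xs.length) (Sum.inr p) = some u := by
      obtain ⟨i, m, h⟩ := h3 p
      exact ⟨(i, m), Diagram.trace_of_route h
        ((lt_card_of_route _ h).trans_le (Diagram.card_place_le hxs))⟩
    refine ⟨?_, fun j => ?_⟩
    · simp only [checkState, Bool.and_eq_true, List.all_eq_true, Bool.or_eq_true,
        Option.isSome_iff_exists]
      refine ⟨fun c _ => ⟨htr _, htr _⟩, fun c _ => ?_⟩
      cases hc : s c
      · exact .inl rfl
      · have hc' := (T.mem_smoothed s c).2 hc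
        refine .inr ⟨(Kind.isReal_iff _).2 (h1 c hc'), ?_⟩
        obtain ⟨u, hu⟩ := htr (Sum.inl (c, (T.kind c).over))
        obtain ⟨v, hv⟩ := htr (Sum.inl (c, !(T.kind c).over))
        rw [hu, hv, hbefore]
        exact h4 c hc' _ _ _ _ (Diagram.route_of_trace hu) (Diagram.route_of_trace hv)
    -- From an output one more step back is needed than from a place, hence the bound `2 * xs.length
    -- + 1`.
    · have : ∃ u, trace T.next.symm s (2 * xs.length + 1) (Sum.inl j) = some u := by
        rw [trace]
        cases T.next.symm (Sum.inl j) with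
        | inl k => exact ⟨_, rfl⟩
        | inr q =>
          obtain ⟨u, hu⟩ := htr (turnAt s q)
          exact ⟨_, congrArg (Option.map _) hu⟩
      obtain ⟨u, hu⟩ := this
      obtain ⟨m, hm⟩ := h2 u.1
      rw [origin, hu, route_inl_unique (Diagram.route_of_trace hu) hm]
      simp
  · rintro ⟨h1, h2⟩
    simp only [checkState, Bool.and_eq_true, List.all_eq_true, Bool.or_eq_true,
      Option.isSome_iff_exists] at h1
    obtain ⟨h3, h4⟩ := h1
    have h5 (c : T.X) (hc : c ∈ T.smoothed s) := (h4 c (hxs c)).resolve_left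
      (by simp [(T.mem_smoothed s c).1 hc])
    refine ⟨fun c hc => (Kind.isReal_iff _).1 (h5 c hc).1, ⟨fun i => ?_, ?_⟩, fun c hc => ?_⟩
    · have := h2 (σ i)
      rw [origin, Option.map_eq_some_iff] at this
      obtain ⟨u, hu, hi⟩ := this
      rw [Equiv.symm_apply_apply] at hi
      rw [← hi]
      exact ⟨_, by rw [Diagram.route_of_trace hu, hi]⟩
    · rintro (⟨c, _ | _⟩ | m)
      · obtain ⟨u, hu⟩ := (h3 c (hxs c)).1
        exact ⟨_, _, Diagram.route_of_trace hu⟩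
      · obtain ⟨u, hu⟩ := (h3 c (hxs c)).2
        exact ⟨_, _, Diagram.route_of_trace hu⟩
      · exact isEmptyElim m
    · intro i m i' m' hi hi'
      have h6 := (h5 c hc).2
      rw [Diagram.trace_of_route hi
          ((lt_card_of_route _ hi).trans_le (Diagram.card_place_le hxs)),
        Diagram.trace_of_route hi'
          ((lt_card_of_route _ hi').trans_le (Diagram.card_place_le hxs)), hbefore] at h6
      exact h6

end Local

/-! ### Comparison of two small diagrams -/

section Compare

variable {A : Type} [DecidableEq A]

/-- The sum of the values with a given label. -/
def labelSum (E : List (A × ℤ)) (a : A) : ℤ :=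
  (E.map fun e => if e.1 = a then e.2 else 0).sum

/-- Check that the sums of values with the same label are equal. -/
def balanced (E E' : List (A × ℤ)) : Bool :=
  (E ++ E').all fun e => decide (labelSum E e.1 = labelSum E' e.1)

theorem labelSum_eq_zero {E : List (A × ℤ)} {a : A} (h : ∀ e ∈ E, e.1 ≠ a) :
    labelSum E a = 0 := by
  refine List.sum_eq_zero fun x hx => ?_
  obtain ⟨e, he, rfl⟩ := List.mem_map.1 hx
  exact if_neg (h e he)

theorem labelSum_eq_of_balanced {E E' : List (A × ℤ)} (h : balanced E E' = true) (a : A) :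
    labelSum E a = labelSum E' a := by
  simp only [balanced, List.all_eq_true, decide_eq_true_eq] at h
  by_cases ha : ∃ e ∈ E ++ E', e.1 = a
  · obtain ⟨e, he, rfl⟩ := ha
    exact h e he
  · push Not at ha
    rw [labelSum_eq_zero fun e he => ha e (List.mem_append_left _ he),
      labelSum_eq_zero fun e he => ha e (List.mem_append_right _ he)]

variable {K : Type} [DecidableEq K]

/-- A state in `entries` is labelled by its degree and by the origins of the outputs, that is, by
`σ⁻¹`; the coefficient for given `n` and `σ` is the total sign of one label. -/
theorem Diagram.coeff_stateSum {T : Diagram K} [IsEmpty T.M] {xs : List T.X}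
    (hxs : ∀ c, c ∈ xs) (hxs' : xs.Nodup) {states : List (T.X → Bool)}
    (hst : ∀ s, s ∈ states) (hst' : states.Nodup) {js : List K} (hjs : ∀ j, j ∈ js)
    {ρ : K → ℕ} (hρ : Function.Injective ρ) (σ : Equiv.Perm K) (n : ℕ) :
    (T.stateSum σ fun k k' => ρ k < ρ k').coeff n =
      labelSum (entries T.next.symm T.kind xs states js ρ) (n, js.map fun j => some (σ.symm j)) := by
  classical
  have hsm : Function.Bijective T.smoothed := by
    constructor
    · intro s s' h
      funext c
      have := T.mem_smoothed s c
      rw [h, T.mem_smoothed] at this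
      exact (Bool.eq_iff_iff.2 this).symm
    · intro S
      refine ⟨fun c => decide (c ∈ S), ?_⟩
      ext c
      simp [T.mem_smoothed]
  have hfilter (s : T.X → Bool) : T.smoothed s = (xs.filter s).toFinset := by
    ext c
    simp [T.mem_smoothed, hxs]
  have huniv : (Finset.univ : Finset (T.X → Bool)) = states.toFinset := by
    ext s
    simp [hst]
  have hkey (s : T.X → Bool) : (∀ j, origin T.next.symm xs s j = some (σ.symm j)) ↔
      js.map (origin T.next.symm xs s) = js.map fun j => some (σ.symm j) := by
    rw [List.map_inj_left]
    exact ⟨fun h j _ => h j, fun h j => h j (hjs j)⟩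
  rw [Diagram.stateSum, ← hsm.sum_comp, Polynomial.finsetSum_coeff, huniv,
    List.sum_toFinset _ hst', labelSum, entries, List.map_map]
  -- The remaining identity holds for every list of states, so it is freed from completeness and
  -- proved by induction on the list.
  clear huniv hst hst'
  induction states with
  | nil => rfl
  | cons s l ih =>
    rw [List.map_cons, List.sum_cons, ih, Diagram.descendsVia_iff_checkState hxs hρ, hkey,
      T.prod_sign, hfilter, List.card_toFinset, (hxs'.filter _).dedup,
      List.prod_toFinset _ (hxs'.filter _), List.filter_cons]
    cases hs : checkState T.next.symm T.kind xs ρ s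
    · simp
    · simp only [true_and, if_true, List.map_cons, List.sum_cons, Function.comp_apply,
        Prod.mk.injEq]
      congr 1
      by_cases h1 : js.map (origin T.next.symm xs s) = js.map fun j => some (σ.symm j)
      · simp [h1, Polynomial.coeff_monomial]
      · simp [h1]

/-- The labels record degree and permutation, so one Boolean check settles all `n` and `σ` at once.
-/
theorem Diagram.stateSum_congr {T T' : Diagram K} [IsEmpty T.M] [IsEmpty T'.M]
    {xs : List T.X} (hxs : (∀ c, c ∈ xs) ∧ xs.Nodup)
    {xs' : List T'.X} (hxs' : (∀ c, c ∈ xs') ∧ xs'.Nodup)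
    {states : List (T.X → Bool)} (hst : (∀ s, s ∈ states) ∧ states.Nodup)
    {states' : List (T'.X → Bool)} (hst' : (∀ s, s ∈ states') ∧ states'.Nodup)
    {js : List K} (hjs : ∀ j, j ∈ js) {ρ : K → ℕ} (hρ : Function.Injective ρ)
    (h : balanced (entries T.next.symm T.kind xs states js ρ)
      (entries T'.next.symm T'.kind xs' states' js ρ) = true)
    (σ : Equiv.Perm K) :
    T.stateSum σ (fun k k' => ρ k < ρ k') = T'.stateSum σ fun k k' => ρ k < ρ k' := by
  ext n
  rw [Diagram.coeff_stateSum hxs.1 hxs.2 hst.1 hst.2 hjs hρ,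
    Diagram.coeff_stateSum hxs'.1 hxs'.2 hst'.1 hst'.2 hjs hρ, labelSum_eq_of_balanced h]

end Compare

/-! ### Invariance under the Reidemeister moves -/

section Moves

/-- The kinds of crossings. -/
def kinds : List Kind := [.pos, .neg, .virt]

theorem mem_kinds (κ : Kind) : κ ∈ kinds := by cases κ <;> simp [kinds]

/-- A function on `Fin 3`, in a form that is fast to evaluate. -/
def triple {α : Type} (a b c : α) (i : Fin 3) : α :=
  bif Nat.beq i.val 0 then a else bif Nat.beq i.val 1 then b else c

theorem triple_eta {α : Type} (f : Fin 3 → α) : triple (f 0) (f 1) (f 2) = f := by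
  ext i
  fin_cases i <;> rfl

/-- The functions on `Fin 3` with values in a list. -/
def triples {α : Type} (l : List α) : List (Fin 3 → α) :=
  l.flatMap fun a => l.flatMap fun b => l.map fun c => triple a b c

theorem mem_triples {α : Type} {l : List α} (h : ∀ a, a ∈ l) (f : Fin 3 → α) : f ∈ triples l := by
  simp only [triples, List.mem_flatMap, List.mem_map]
  exact ⟨f 0, h _, f 1, h _, f 2, h _, triple_eta f⟩

/-- The kinds of the crossings of a triangle with the lines one above the other, or with at most
one real crossing. -/
def triangleKinds (o : Fin 3 → Bool) : List (Fin 3 → Kind) :=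
  ([triple false false true, triple false true false, triple true false false,
    triple false true true,
    triple true false true, triple true true false].map fun b i =>
      bif b i == (triangleSide o i == left) then Kind.pos else Kind.neg) ++
  kinds.flatMap fun κ => [triple κ .virt .virt, triple .virt κ .virt, triple .virt .virt κ]

/-- The orders of three strings. -/
def ranks : List (Fin 3 → ℕ) :=
  [triple 0 1 2, triple 0 2 1, triple 1 0 2, triple 1 2 0, triple 2 0 1, triple 2 1 0]

/-- The descending states of a triangle; the arcs do not depend on the kinds of crossings. -/
def triangleEntries (o : Fin 3 → Bool) (κ : Fin 3 → Kind) (ρ : Fin 3 → ℕ) :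
    List ((ℕ × List (Option (Fin 3))) × ℤ) :=
  entries (X := Fin 3) (M := Empty) (triangle o fun _ => .virt).next.symm κ [0, 1, 2]
    (triples [false, true]) [0, 1, 2] ρ

/-- Only directions with `o 0` true are evaluated: the reversal of all lines exchanges the two sides
of the move. -/
theorem balanced_triangleEntries : (((triples [false, true]).filter fun o => o 0).all fun o =>
    (triangleKinds o).all fun κ => ranks.all fun ρ =>
      balanced (triangleEntries o κ ρ) (triangleEntries (fun i => !o i) κ ρ)) = true := by
  decide +kernel

theorem mem_triangleKinds {o : Fin 3 → Bool} {κ : Fin 3 → Kind} (h : TriangleAdmissible o κ) :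
    κ ∈ triangleKinds o := by
  rcases h with ⟨h, hκ⟩ | ⟨j, hj⟩
  · refine List.mem_append_left _ (List.mem_map.2
      ⟨fun i => decide (h (i + 1) < h i), ?_, funext fun i => ?_⟩)
    · rw [← triple_eta fun i => decide (h (i + 1) < h i)]
      change triple (decide (h 1 < h 0)) (decide (h 2 < h 1)) (decide (h 0 < h 2)) ∈ _
      -- Around the cycle the heights can neither always fall nor never fall; the other six patterns
      -- are those in the list.
      have h0 : ¬ (h 1 < h 0 ∧ h 2 < h 1 ∧ h 0 < h 2) := by omega
      have h1 : ¬ (¬ h 1 < h 0 ∧ ¬ h 2 < h 1 ∧ ¬ h 0 < h 2) := by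
        have : h 0 ≠ h 1 := h.injective.ne (by decide)
        omega
      by_cases h2 : h 1 < h 0 <;> by_cases h3 : h 2 < h 1 <;> by_cases h4 : h 0 < h 2 <;>
        first
        | (exfalso; tauto)
        | simp only [h2, h3, h4, decide_true, decide_false, List.mem_cons, true_or, or_true]
    · rw [hκ i]
      by_cases h1 : h (i + 1) < h i <;> cases triangleSide o i <;> simp [h1]
  · refine List.mem_append_right _ (List.mem_flatMap.2 ⟨κ j, mem_kinds _, ?_⟩)
    simp only [List.mem_cons, List.not_mem_nil, or_false]
    fin_cases j
    · exact .inl (by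
        conv_lhs => rw [← triple_eta κ, hj 1 (by decide), hj 2 (by decide)]
        rfl)
    · exact .inr (.inl (by
        conv_lhs => rw [← triple_eta κ, hj 0 (by decide), hj 2 (by decide)]
        rfl))
    · exact .inr (.inr (by
        conv_lhs => rw [← triple_eta κ, hj 0 (by decide), hj 1 (by decide)]
        rfl))

theorem mem_ranks {ρ : Fin 3 → ℕ} (h : ∀ k, ρ k < 3) (hρ : Function.Injective ρ) :
    ρ ∈ ranks := by
  have h01 : ρ 0 ≠ ρ 1 := hρ.ne (by decide)
  have h02 : ρ 0 ≠ ρ 2 := hρ.ne (by decide)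
  have h12 : ρ 1 ≠ ρ 2 := hρ.ne (by decide)
  have h0 := h 0
  have h1 := h 1
  have h2 := h 2
  rw [← triple_eta ρ]
  generalize ρ 0 = a at *
  generalize ρ 1 = b at *
  generalize ρ 2 = c at *
  interval_cases a <;> interval_cases b <;> interval_cases c <;> simp_all [ranks]

theorem triangle_stateSum {o : Fin 3 → Bool} {κ : Fin 3 → Kind} (h : TriangleAdmissible o κ)
    {ρ : Fin 3 → ℕ} (h3 : ∀ k, ρ k < 3) (hρ : Function.Injective ρ) (σ : Equiv.Perm (Fin 3)) :
    (triangle o κ).stateSum σ (fun k k' => ρ k < ρ k') =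
      (triangle (fun i => !o i) κ).stateSum σ fun k k' => ρ k < ρ k' := by
  wlog ho : o 0 = true generalizing o with H
  -- `triangleSide` only compares two directions, so it is unchanged when all are reversed.
  · have h' : TriangleAdmissible (fun i => !o i) κ := by
      simpa [TriangleAdmissible, triangleSide] using h
    have := H h' (by simpa using ho)
    simp only [Bool.not_not] at this
    exact this.symm
  have hE (o : Fin 3 → Bool) : IsEmpty (triangle o κ).M := inferInstanceAs (IsEmpty Empty)
  have hxs : (∀ c : Fin 3, c ∈ [0, 1, 2]) ∧ [(0 : Fin 3), 1, 2].Nodup := by decide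
  have hst : (∀ s : Fin 3 → Bool, s ∈ triples [false, true]) ∧
      (triples [false, true]).Nodup := ⟨mem_triples (by simp), by decide⟩
  refine Diagram.stateSum_congr (T := triangle o κ) (T' := triangle (fun i => !o i) κ)
    hxs hxs hst hst (js := [0, 1, 2]) hxs.1 hρ ?_ σ
  have := List.all_eq_true.1 balanced_triangleEntries o
    (List.mem_filter.2 ⟨mem_triples (by simp) o, ho⟩)
  exact List.all_eq_true.1 (List.all_eq_true.1 this κ (mem_triangleKinds h)) ρ (mem_ranks h3 hρ)

/-! ### Bigons and kinks -/

/-- A function on `Bool`, in a form that is fast to evaluate. -/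
def pair {α : Type} (a b : α) (i : Bool) : α :=
  bif i then b else a

theorem pair_eta {α : Type} (f : Bool → α) : pair (f false) (f true) = f := by
  funext i
  cases i <;> rfl

/-- The sets of crossings of a bigon. -/
def sideStates : List (Bool → Bool) :=
  [pair false false, pair false true, pair true false, pair true true]

/-- The orders of two strings. -/
def sideRanks : List (Bool → ℕ) := [pair 0 1, pair 1 0]

theorem mem_sideRanks {ρ : Bool → ℕ} (h : ∀ k, ρ k < 2) (hρ : Function.Injective ρ) :
    ρ ∈ sideRanks := by
  have h01 : ρ false ≠ ρ true := hρ.ne (by decide)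
  have h0 := h false
  have h1 := h true
  rw [← pair_eta ρ]
  generalize ρ false = a at *
  generalize ρ true = b at *
  interval_cases a <;> interval_cases b <;> simp_all [sideRanks]

theorem sideStates_complete : (∀ s, s ∈ sideStates) ∧ sideStates.Nodup := by decide

theorem sides_complete : (∀ b : Bool, b ∈ [false, true]) ∧ [false, true].Nodup := by decide

/-- The only set of crossings of a diagram without crossings. -/
def noState : List (Empty → Bool) := [Empty.elim]

theorem noState_complete : (∀ s, s ∈ noState) ∧ noState.Nodup := by decide

theorem noCrossing_complete : (∀ c : Empty, c ∈ []) ∧ ([] : List Empty).Nodup := by decide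

instance (K : Type) : IsEmpty (trivialDiagram K).M := inferInstanceAs (IsEmpty Empty)

instance (κ : Kind) : IsEmpty (bigonParallel κ).M := inferInstanceAs (IsEmpty Empty)

instance (κ : Kind) (s : Side) : IsEmpty (bigonOpposite κ s).M := inferInstanceAs (IsEmpty Empty)

instance (κ : Kind) (s : Side) : IsEmpty (kink κ s).M := inferInstanceAs (IsEmpty Empty)

/-- The descending state of a diagram without crossings. -/
def trivialEntries {K : Type} (js : List K) (ρ : K → ℕ) : List ((ℕ × List (Option K)) × ℤ) :=
  entries (X := Empty) (M := Empty) (trivialDiagram K).next.symm Empty.elim [] noState js ρ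

theorem balanced_bigonParallel : (kinds.all fun κ => sideRanks.all fun ρ =>
    balanced (entries (X := Bool) (M := Empty) (bigonParallel κ).next.symm (bigonParallel κ).kind
      [false, true] sideStates [false, true] ρ) (trivialEntries [false, true] ρ)) = true := by
  decide +kernel

theorem balanced_bigonOpposite : (kinds.all fun κ => [false, true].all fun s =>
    sideRanks.all fun ρ => balanced (entries (X := Bool) (M := Empty)
      (bigonOpposite κ s).next.symm (bigonOpposite κ s).kind [false, true] sideStates
      [false, true] ρ) (trivialEntries [false, true] ρ)) = true := by
  decide +kernel

/-- The sets of crossings of a kink. -/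
def unitStates : List (Unit → Bool) := [fun _ => false, fun _ => true]

theorem unitStates_complete : (∀ s, s ∈ unitStates) ∧ unitStates.Nodup := by decide

theorem unit_complete : (∀ c : Unit, c ∈ [()]) ∧ [()].Nodup := by simp

theorem balanced_kink : (kinds.all fun κ => [false, true].all fun s =>
    balanced (entries (X := Unit) (M := Empty)
      (kink κ s).next.symm (kink κ s).kind [()] unitStates
      [()] fun _ => 0) (trivialEntries [()] fun _ => 0)) = true := by
  decide +kernel

theorem Elementary.stateSum_eq {K : Type} [Fintype K] {T T' : Diagram K} (h : Elementary T T')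
    (σ : Equiv.Perm K) (ρ : K → ℕ) (hc : ∀ k, ρ k < Fintype.card K)
    (hρ : Function.Injective ρ) :
    T.stateSum σ (fun k k' => ρ k < ρ k') = T'.stateSum σ fun k k' => ρ k < ρ k' := by
  -- The given `Fintype` instance need not be the standard one; `Nat.card` does not depend on it.
  have hU : Nat.card Unit = 1 := by simp
  have hB : Nat.card Bool = 2 := by simp
  have hF : Nat.card (Fin 3) = 3 := by simp
  rw [← Nat.card_eq_fintype_card] at hc
  cases h with
  | first κ s =>
    have h1 : ρ = fun _ => 0 := funext fun k => by
      have := hc k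
      rw [hU] at this
      omega
    have := List.all_eq_true.1 (List.all_eq_true.1 balanced_kink κ (mem_kinds κ)) s
      (sides_complete.1 s)
    rw [h1] at hρ ⊢
    exact Diagram.stateSum_congr (T := kink κ s) (T' := trivialDiagram Unit)
      unit_complete noCrossing_complete unitStates_complete noState_complete unit_complete.1
      hρ this σ
  | secondParallel κ =>
    rw [hB] at hc
    exact Diagram.stateSum_congr (T := bigonParallel κ) (T' := trivialDiagram Side)
      sides_complete noCrossing_complete sideStates_complete noState_complete sides_complete.1 hρ
      (List.all_eq_true.1 (List.all_eq_true.1 balanced_bigonParallel κ (mem_kinds κ)) ρ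
        (mem_sideRanks hc hρ)) σ
  | secondOpposite κ s =>
    rw [hB] at hc
    exact Diagram.stateSum_congr (T := bigonOpposite κ s) (T' := trivialDiagram Bool)
      sides_complete noCrossing_complete sideStates_complete noState_complete sides_complete.1 hρ
      (List.all_eq_true.1 (List.all_eq_true.1 (List.all_eq_true.1 balanced_bigonOpposite κ
        (mem_kinds κ)) s (sides_complete.1 s)) ρ (mem_sideRanks hc hρ)) σ
  | third o κ h =>
    rw [hF] at hc
    exact triangle_stateSum h hc hρ σ

theorem Move.conway_eq {I : Type} [LinearOrder I] {D D' : Diagram I} (h : Move D D') :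
    D.conway = D'.conway := by
  cases h with
  | iso e => exact e.conway_eq
  | addMark D a => exact (D.addMark_conway a).symm
  | reidemeister C h => exact C.conway_fill_congr h.stateSum_eq

end Moves

end OrderedTangle

/-! ### Descent to ordered tangles -/

theorem theorem1 {n : ℕ} (pos : Fin n ⊕ Fin n ≃ Fin (2 * n)) :
    (∃! nabla : OrderedTangle.VirtualTangle pos → Polynomial ℤ,
      ∀ D : OrderedTangle.VirtualDiagram pos,
        nabla (OrderedTangle.VirtualTangle.mk D) = D.1.conway) ∧
    (∃! nabla : OrderedTangle.ClassicalTangle pos → Polynomial ℤ,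
      ∀ D : OrderedTangle.ClassicalDiagram pos,
        nabla (OrderedTangle.ClassicalTangle.mk D) = D.1.conway) := by
  constructor
  · refine ⟨Quot.lift (fun D => D.1.conway) fun _ _ h => h.conway_eq, fun _ => rfl, ?_⟩
    rintro nabla h
    funext x
    induction x using Quot.ind with
    | mk D => exact h D
  · refine ⟨Quot.lift (fun D => D.1.conway) fun _ _ h => h.conway_eq, fun _ => rfl, ?_⟩
    rintro nabla h
    funext x
    induction x using Quot.ind with
    | mk D => exact h D
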